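/- Conventions. Let $G$ be a group and $H\le G$ a subgroup. A subset $W\subseteq G$ is $H$-finite if it is contained in the union of finitely many cosets $Hg$; two subsets of $G$ are $H$-almost equal if their symmetric difference is $H$-finite. Write $U^*=G\setminus U$. A subset $X\subseteq G$ is $H$-almost invariant if $HX=X$ and $Xg$ is $H$-almost equal to $X$ for all $g\in G$ (equivalently, $H\backslash X$ is an almost invariant subset of $H\backslash G$); it is non-trivial if neither $X$ nor $X^*$ is $H$-finite. If $U$ is $H_U$-almost invariant and $V$ is $H_V$-almost invariant, each of the four corner sets $U\cap V,\ U^*\cap V,\ U\cap V^*,\ U^*\cap V^*$ (written $U^{(*)}\cap V^{(*)}$) is called small if it is $H_U$-finite. For a translate $gX$ or $gX^*$ of an $H$-almost invariant set $X$ or its complement one takes the subgroup $gHg^{-1}$. A collection $E$ of such sets, closed under complementation, is almost nested if for all $U,V\in E$ at least one of the four sets $U^{(*)}\cap V^{(*)}$ is small. A splitting of $G$ over a subgroup $C$ is either a pair of proper subgroups $A,B$ of $G$, both containing $C$, such that the natural map $A*_CB\to G$ is an isomorphism; or a subgroup $A$ of $G$, subgroups $C_0$ and $C_1=C$ of $A$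 and an element $t\in G$ with $tC_0t^{-1}=C_1$ such that the natural map from the HNN extension $\langle A,t : tct^{-1}=\varphi(c),\ c\in C_0\rangle$ to $G$, where $\varphi(c)=tct^{-1}$, is an isomorphism. The splitting determines a set $Z\subseteq G$: for $A*_CB$, the set of elements that have a reduced word (with letters alternately in $A\setminus C$ and $B\setminus C$) whose first letter lies in $A\setminus C$; for an HNN extension, the set of elements that have a reduced word of the form $a_1t\cdots$ with $a_1\in C_1$. The four sets $Z,\ Z\cup C,\ Z^*,\ Z^*\setminus C$ are the standard $C$-almost invariant sets determined by the splitting. Theorem. (1) Let $H$ be a finitely generated subgroup of a finitely generated group $G$. Let $X$ be a non-trivial $H$-almost invariant set in $G$ such that $E=\{gX,gX^*:g\in G\}$ is almost nested and such that, for every $g\in G$, if two of the four sets $X^{(*)}\cap gX^{(*)}$ are small, then at least one of these two is empty. Let $H'=\{g\in G: gX=X\}$ be the stabiliser of $X$. Then $H'$ contains $H$ as a subgroup of finite index, and $G$ has a splitting over $H'$ such that one of the standard $H'$-almost invariant sets determined by the splitting is $H$-almost equal to $X$. (2) Let $k\ge 0$ and let $H_1,\dots,H_k$ be finitely generated subgroups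 of a finitely generated group $G$. For $1\le i\le k$ let $X_i$ be a non-trivial $H_i$-almost invariant set in $G$, such that $E=\{gX_i,gX_i^*:1\le i\le k,\ g\in G\}$ is almost nested. Suppose further that for all $U,V\in E$, if two of the four sets $U^{(*)}\cap V^{(*)}$ are small, then at least one of these two is empty. Let $H_i'$ be the stabiliser of $X_i$. Then each $H_i'$ contains $H_i$ as a subgroup of finite index, and $G$ can be expressed as the fundamental group of a connected graph of groups with exactly $k$ edges such that, for each $i$, there is a splitting $s_i$ of $G$ over $H_i'$ with the following two properties: collapsing all edges but the $i$-th yields a conjugate of $s_i$; and one of the standard $H_i'$-almost invariant sets determined by $s_i$ is $H_i$-almost equal to $X_i$. -/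

import Mathlib

open scoped Pointwise

universe u

namespace AlmostInvariant

section Sets

variable {G : Type*} [Group G]

/-- `W` is `H`-finite: it is contained in a union of finitely many cosets `Hg`. -/
def FiniteOver (H : Subgroup G) (W : Set G) : Prop :=
  ∃ F : Set G, F.Finite ∧ W ⊆ (H : Set G) * F

/-- `V` and `W` are `H`-almost equal: their symmetric difference is `H`-finite. -/
def AlmostEqual (H : Subgroup G) (V W : Set G) : Prop :=
  FiniteOver H (symmDiff V W)

/-- `X` is `H`-almost invariant: `HX = X`, and `Xg` is `H`-almost equal to `X` for every `g`;
for a left `H`-invariant `X` the latter says that the image `P` of `X` in `H\G` differs from `Pg`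
by finitely many points. -/
def IsAlmostInvariant (H : Subgroup G) (X : Set G) : Prop :=
  (∀ h ∈ H, h • X = X) ∧ ∀ g : G, AlmostEqual H (X * {g}) X

/-- `X` is a non-trivial `H`-almost invariant set: moreover `H\X` and `H\(G - X)` are infinite. -/
def IsNontrivialAlmostInvariant (H : Subgroup G) (X : Set G) : Prop :=
  IsAlmostInvariant H X ∧ ¬ FiniteOver H X ∧ ¬ FiniteOver H Xᶜ

/-- The set `U` itself or its complement. -/
def side (U : Set G) : Bool → Set G
  | true => U
  | false => Uᶜ

/-- The four corner sets of `U` and `V`. -/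
def corner (U V : Set G) (a b : Bool) : Set G :=
  side U a ∩ side V b

/-- The collection of all `g X i` and `(g X i)ᶜ`, each recorded together with the subgroup
`g (H i) g⁻¹` over which it is almost invariant. -/
def translates {ι : Type*} (H : ι → Subgroup G) (X : ι → Set G) : Set (Subgroup G × Set G) :=
  {p | ∃ (i : ι) (g : G) (a : Bool), p = (MulAut.conj g • H i, side (g • X i) a)}

/-- A collection of sets `U`, each almost invariant over a given subgroup `H_U`, is almost nested
if for any two members `U`, `V` one of the four corners is small, that is, `H_U`-finite. -/
def AlmostNested (E : Set (Subgroup G × Set G)) : Prop :=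
  ∀ p ∈ E, ∀ q ∈ E, ∃ a b : Bool, FiniteOver p.1 (corner p.2 q.2 a b)

/-- If two of the four corners of `U` and `V` are small (`H`-finite, where `U` is `H`-almost
invariant), then at least one of these two is empty. -/
def SmallPairHasEmpty (H : Subgroup G) (U V : Set G) : Prop :=
  ∀ a b c d : Bool, (a, b) ≠ (c, d) →
    FiniteOver H (corner U V a b) → FiniteOver H (corner U V c d) →
      corner U V a b = ∅ ∨ corner U V c d = ∅

end Sets

section Splittings

/-- A splitting of `G` as an amalgamated free product: proper subgroups `A = factor true` and
`B = factor false` of `G` and a subgroup `C = edge` of both, such that the natural map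
`A *_C B → G` is an isomorphism. -/
structure AmalgamSplitting (G : Type*) [Group G] where
  factor : Bool → Subgroup G
  edge : Subgroup G
  edge_le : ∀ b, edge ≤ factor b
  proper : ∀ b, factor b ≠ ⊤
  bijective : Function.Bijective
    (Monoid.PushoutI.lift (φ := fun b => Subgroup.inclusion (edge_le b))
      (fun b => (factor b).subtype) edge.subtype (fun _ => rfl))

/-- A splitting of `G` as an HNN extension: a subgroup `A = vertex` of `G`, subgroups `C₀`, `C₁`
of `A` and an element `t` of `G` with `t C₀ t⁻¹ = C₁`, such that the natural map
`⟨A, t : t c t⁻¹ = φ c for c in C₀⟩ → G` is an isomorphism. -/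
structure HNNSplitting (G : Type*) [Group G] where
  vertex : Subgroup G
  C₀ : Subgroup vertex
  C₁ : Subgroup vertex
  φ : C₀ ≃* C₁
  t : G
  conj_t : ∀ c : C₀, t * vertex.subtype c = vertex.subtype (φ c) * t
  bijective : Function.Bijective (HNNExtension.lift vertex.subtype t conj_t)

/-- A splitting of `G`. -/
inductive Splitting (G : Type*) [Group G] where
  | amalgam (s : AmalgamSplitting G)
  | hnn (s : HNNSplitting G)

namespace Splitting

variable {G : Type*} [Group G]

/-- The subgroup of `G` over which the splitting is. -/
def edge : Splitting G → Subgroup G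
  | amalgam s => s.edge
  | hnn s => s.C₁.map s.vertex.subtype

/-- For `G = A *_C B`: the elements whose normal form `a₁ b₁ a₂ ⋯ aₙ bₙ c` has `a₁` non-trivial,
that is, those having a reduced word whose first letter lies in `A - C`.
For an HNN extension: the elements whose normal form `a₁ t^ε₁ a₂ t^ε₂ ⋯` (with `a₁` in a
transversal of `C₁`, containing `1`, if `ε₁ = 1`) begins with trivial `a₁` and `ε₁ = 1`, that is,
those having a reduced word `a₁ t ⋯` with `a₁` in `C₁`. -/
def baseSet : Splitting G → Set G
  | amalgam s => {g | ∃ w : Monoid.CoprodI.Word (fun b => s.factor b),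
      Monoid.PushoutI.Reduced (fun b => Subgroup.inclusion (s.edge_le b)) w ∧
      w.fstIdx = some true ∧
      Monoid.CoprodI.lift (fun b => (s.factor b).subtype) w.prod = g}
  | hnn s => {g | ∃ w : HNNExtension.NormalWord.ReducedWord s.vertex s.C₀ s.C₁,
      w.head ∈ s.C₁ ∧ w.toList.head?.map Prod.fst = some 1 ∧
      HNNExtension.lift s.vertex.subtype s.t s.conj_t (w.prod s.φ) = g}

/-- The four standard almost invariant sets `X`, `X ∪ C`, `Xᶜ`, `Xᶜ - C` in `G` determined by a
splitting over `C`. -/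
def IsStandardSet (s : Splitting G) (Y : Set G) : Prop :=
  Y = s.baseSet ∨ Y = s.baseSet ∪ s.edge ∨ Y = s.baseSetᶜ ∨ Y = s.baseSetᶜ \ s.edge

end Splitting

end Splittings

section GraphsOfGroups

/-- A connected graph of groups with vertex set `V` and set of geometric edges `E`; each edge has
a chosen orientation, and loops and multiple edges are allowed. -/
structure GraphOfGroups (V E : Type*) where
  src : E → V
  tgt : E → V
  connected : ∀ u v : V, Relation.EqvGen (fun a b => ∃ e, src e = a ∧ tgt e = b) u v
  vertexGroup : V → Type*
  edgeGroup : E → Type*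
  [vertexGroup_group : ∀ v, Group (vertexGroup v)]
  [edgeGroup_group : ∀ e, Group (edgeGroup e)]
  srcHom : ∀ e, edgeGroup e →* vertexGroup (src e)
  tgtHom : ∀ e, edgeGroup e →* vertexGroup (tgt e)
  srcHom_injective : ∀ e, Function.Injective (srcHom e)
  tgtHom_injective : ∀ e, Function.Injective (tgtHom e)

namespace GraphOfGroups

attribute [instance] vertexGroup_group edgeGroup_group

variable {V E : Type*} (𝒢 : GraphOfGroups V E)

/-- The free product of all vertex groups and the free group on the edges. -/
abbrev PrePathGroup : Type _ :=
  Monoid.Coprod (Monoid.CoprodI 𝒢.vertexGroup) (FreeGroup E)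

/-- The relators of `e · tgtHom e a · e⁻¹ = srcHom e a`. -/
def relators : Set 𝒢.PrePathGroup :=
  {r | ∃ (e : E) (a : 𝒢.edgeGroup e),
    r = Monoid.Coprod.inr (FreeGroup.of e)
      * Monoid.Coprod.inl (Monoid.CoprodI.of (𝒢.tgtHom e a))
      * (Monoid.Coprod.inr (FreeGroup.of e))⁻¹
      * (Monoid.Coprod.inl (Monoid.CoprodI.of (𝒢.srcHom e a)))⁻¹}

/-- The path group `F(𝒢)` of Bass and Serre. -/
abbrev PathGroup : Type _ :=
  𝒢.PrePathGroup ⧸ Subgroup.normalClosure 𝒢.relators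

/-- The map of a vertex group to the path group. -/
def ofVertex (v : V) : 𝒢.vertexGroup v →* 𝒢.PathGroup :=
  (QuotientGroup.mk' _).comp (Monoid.Coprod.inl.comp Monoid.CoprodI.of)

/-- The element of the path group given by an edge. -/
def letter (e : E) : 𝒢.PathGroup :=
  QuotientGroup.mk' _ (Monoid.Coprod.inr (FreeGroup.of e))

/-- `IsPath S u v x`: the element `x` of the path group is the class `g₀ e₁ g₁ ⋯ eₙ gₙ` of an edge
path from `u` to `v`, with elements of the vertex groups inserted at the vertices it runs through,
that only uses edges from `S` (in either direction). -/
inductive IsPath (S : Set E) : V → V → 𝒢.PathGroup → Prop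
  | vertex (v : V) (g : 𝒢.vertexGroup v) : IsPath S v v (𝒢.ofVertex v g)
  | edge (e : E) (he : e ∈ S) : IsPath S (𝒢.src e) (𝒢.tgt e) (𝒢.letter e)
  | edge_inv (e : E) (he : e ∈ S) : IsPath S (𝒢.tgt e) (𝒢.src e) (𝒢.letter e)⁻¹
  | comp {u v w : V} {x y : 𝒢.PathGroup} :
      IsPath S u v x → IsPath S v w y → IsPath S u w (x * y)

theorem IsPath.inv {S : Set E} {u v : V} {x : 𝒢.PathGroup} (h : 𝒢.IsPath S u v x) :
    𝒢.IsPath S v u x⁻¹ := by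
  induction h with
  | vertex v g => rw [← map_inv]; exact .vertex v g⁻¹
  | edge e he => exact .edge_inv e he
  | edge_inv e he => rw [inv_inv]; exact .edge e he
  | comp _ _ hx hy => rw [mul_inv_rev]; exact .comp hy hx

/-- The classes of loops at `v` that only use edges from `S`: the fundamental group, based at `v`,
of the component of `v` in the graph of groups with edge set `S`. -/
def loops (S : Set E) (v : V) : Subgroup 𝒢.PathGroup where
  carrier := {x | 𝒢.IsPath S v v x}
  mul_mem' := .comp
  one_mem' := by
    have h := IsPath.vertex (𝒢 := 𝒢) (S := S) v 1
    rwa [map_one] at h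
  inv_mem' h := IsPath.inv 𝒢 h

/-- The fundamental group of a graph of groups, based at `v`. -/
abbrev FundamentalGroup (v : V) : Type _ :=
  𝒢.loops Set.univ v

/-- The image in the path group of the edge group of `e`, taken at the source of `e`. -/
def edgeImage (e : E) : Subgroup 𝒢.PathGroup :=
  ((𝒢.ofVertex (𝒢.src e)).comp (𝒢.srcHom e)).range

variable {G : Type*} [Group G]

/-- Let `θ` be an isomorphism of the fundamental group based at `v₀` with `G`. A subgroup `L` of
the fundamental group based at another vertex is carried into `G` along a path `p` from `v₀` to
that vertex, as `θ (p L p⁻¹)`. -/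
def transport {v₀ : V} (θ : 𝒢.FundamentalGroup v₀ ≃* G) (p : 𝒢.PathGroup)
    (L : Subgroup 𝒢.PathGroup) : Subgroup G :=
  ((MulAut.conj p • L).subgroupOf (𝒢.loops Set.univ v₀)).map θ.toMonoidHom

/-- Let `G` be expressed as the fundamental group of `𝒢` by `θ`. Collapsing all edges of `𝒢` but
`e` yields, up to conjugacy in `G`, the splitting `s`. After the collapse, each component of the
graph without `e` has become one vertex, whose group is the fundamental group of that component.
If `e` separates the graph, the result is an amalgamated free product, otherwise it is an HNN
extension with stable letter `e q`, where `q` leads back from the target of `e` to its source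
without using `e`. The path `p` from the base point to `e` accounts for the conjugation. -/
def CollapsesTo {v₀ : V} (θ : 𝒢.FundamentalGroup v₀ ≃* G) (e : E) : Splitting G → Prop
  | .amalgam s =>
      (¬ ∃ q, 𝒢.IsPath {e}ᶜ (𝒢.tgt e) (𝒢.src e) q) ∧
      ∃ p, 𝒢.IsPath Set.univ v₀ (𝒢.src e) p ∧
        s.factor true = 𝒢.transport θ p (𝒢.loops {e}ᶜ (𝒢.src e)) ∧
        s.factor false = 𝒢.transport θ (p * 𝒢.letter e) (𝒢.loops {e}ᶜ (𝒢.tgt e)) ∧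
        s.edge = 𝒢.transport θ p (𝒢.edgeImage e)
  | .hnn s =>
      ∃ p q, 𝒢.IsPath Set.univ v₀ (𝒢.src e) p ∧ 𝒢.IsPath {e}ᶜ (𝒢.tgt e) (𝒢.src e) q ∧
        s.vertex = 𝒢.transport θ p (𝒢.loops {e}ᶜ (𝒢.src e)) ∧
        s.C₁.map s.vertex.subtype = 𝒢.transport θ p (𝒢.edgeImage e) ∧
        ∃ x : 𝒢.FundamentalGroup v₀, (x : 𝒢.PathGroup) = p * 𝒢.letter e * q * p⁻¹ ∧ θ x = s.t

end GraphOfGroups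

end GraphsOfGroups

end AlmostInvariant

open AlmostInvariant

/-!
The translates of the sets `X i` and their complements are turned into the oriented edges of a tree
on which `G` acts, and Bass–Serre theory is applied to this action.

*The order.* For almost invariant sets put `U ≤ V` if `U ∩ Vᶜ` is empty or the only small corner
(`CornerLE`). Smallness of a corner does not depend on which of the two sets is used to define it
(`FiniteOver.symm`), and with this symmetry the relation is a partial order (`CornerLE.trans`), which
is reversed by complementation. Almost nestedness, together with the condition on pairs of small
corners, says that for any `U` and `V` one of them is comparable with the other one or its complement.
Intervals are finite: since the groups `H i` and `G` are finitely generated, up to finitely many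
translations only finitely many translates have four non-empty corners with `U`
(`exists_finite_not_nested`). Hence some point of `U` lies in all `V ≥ U`
(`Edge.exists_mem_of_cornerLE`), so every set between `U` and `V` separates two fixed elements of `G`,
and only finitely many translates do so. The sets `X i` may have common translates, and `X i` may be
a translate of its own complement. Therefore an edge records the index `i` and the orientation besides
the set, and edges with the same set are ordered by a key; in the tree this subdivides an edge.

*The tree.* By Dunwoody's construction an ordered set with these properties (`TreeOrder`) is the set
of oriented edges of a tree. The vertex at which the edge `p` ends is encoded as the set `T.head p` of
all edges that point towards it. Two vertices are joined by a path that only crosses the edges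
separating them (`TreeOrder.rel_head_head`), and the edges of a path without backtracking are
increasing, so that it is not closed.

*The graph of groups.* The stabilizers of orbit representatives form a graph of groups, whose path
group maps to `G` by sending vertex groups to themselves and edges to elements which match up
the representatives. On loops this map is surjective by connectedness of the tree, and injective
because a loop can be reduced until it has no backtracking (`TreeOrder.toGroup_injOn`).

*The splittings.* Collapsing all edges of colors other than `i` amounts to intersecting the sets
`T.head p` with the edges of color `i`. The stabilizers of the two ends of the edge `e` of `X i` in the
collapsed tree are the images of the fundamental groups of the components that are left when the edge
`i` is removed from the graph (`TreeOrder.transport_loops`). The amalgamated free product or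
HNN extension maps onto `G` by connectedness, and injectively by ping-pong: the first letter of a
reduced word determines beyond which end of `e` the word carries `e`. This also identifies the standard
sets of the splitting with the sets of all `g` that carry `e` beyond a given end. By the choice of a
point in all `V ≥ X i` and a point in all `V ≥ (X i)ᶜ`, membership of `g` in such a set agrees, up to a
finite set of cosets, with membership of `g` in `X i` (`Edge.finiteOver_beyond`).
-/


/-! ### Subsets that are finite modulo a subgroup, and almost invariant sets -/

namespace AlmostInvariant

section FiniteOver

variable {G : Type*} [Group G] {H K : Subgroup G} {S T U V W X : Set G}

theorem FiniteOver.mono (h : FiniteOver H T) (hST : S ⊆ T) : FiniteOver H S :=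
  let ⟨F, hF, hT⟩ := h
  ⟨F, hF, hST.trans hT⟩

theorem FiniteOver.union (hS : FiniteOver H S) (hT : FiniteOver H T) : FiniteOver H (S ∪ T) := by
  obtain ⟨F, hF, hS⟩ := hS
  obtain ⟨F', hF', hT⟩ := hT
  refine ⟨F ∪ F', hF.union hF', ?_⟩
  rw [Set.mul_union]
  exact Set.union_subset_union hS hT

theorem FiniteOver.empty : FiniteOver H (∅ : Set G) := ⟨∅, Set.finite_empty, by simp⟩

theorem FiniteOver.mul_finite (hS : FiniteOver H S) (hT : T.Finite) : FiniteOver H (S * T) := by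
  obtain ⟨F, hF, hS⟩ := hS
  exact ⟨F * T, hF.mul hT, by rw [← mul_assoc]; exact Set.mul_subset_mul_right hS⟩

theorem FiniteOver.biUnion {ι : Type*} {I : Set ι} (hI : I.Finite) {f : ι → Set G}
    (hf : ∀ i ∈ I, FiniteOver H (f i)) : FiniteOver H (⋃ i ∈ I, f i) := by
  induction I, hI using Set.Finite.induction_on with
  | empty => simpa using FiniteOver.empty
  | insert _ _ ih =>
    rw [Set.biUnion_insert]
    exact (hf _ (Set.mem_insert _ _)).union (ih fun i hi => hf i (Set.mem_insert_of_mem _ hi))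

theorem FiniteOver.of_subgroup_le (h : FiniteOver H S) (hHK : H ≤ K) : FiniteOver K S :=
  let ⟨F, hF, hS⟩ := h
  ⟨F, hF, hS.trans (Set.mul_subset_mul_right hHK)⟩

theorem FiniteOver.of_finiteOver_subgroup (h : FiniteOver K S) (hHK : FiniteOver H (K : Set G)) :
    FiniteOver H S :=
  let ⟨_, hF, hS⟩ := h
  (hHK.mul_finite hF).mono hS

theorem FiniteOver.smul_of_mem {h : G} (hh : h ∈ H) (hS : FiniteOver H S) : FiniteOver H (h • S) := by
  obtain ⟨F, hF, hS⟩ := hS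
  refine ⟨F, hF, ?_⟩
  rintro _ ⟨s, hs, rfl⟩
  obtain ⟨x, hx, f, hf, rfl⟩ := hS hs
  exact ⟨h * x, H.mul_mem hh hx, f, hf, mul_assoc _ _ _⟩

/-- Finiteness over a conjugate, in terms of the translate of the set. -/
theorem finiteOver_conj (g : G) :
    FiniteOver (MulAut.conj g • H) S ↔ FiniteOver H (g⁻¹ • S) := by
  constructor
  · rintro ⟨F, hF, hS⟩
    refine ⟨g⁻¹ • F, hF.smul_set, ?_⟩
    rintro _ ⟨s, hs, rfl⟩
    obtain ⟨_, ⟨h, hh, rfl⟩, f, hf, rfl⟩ := hS hs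
    exact ⟨h, hh, _, Set.smul_mem_smul_set hf, by simp [mul_assoc]⟩
  · rintro ⟨F, hF, hS⟩
    refine ⟨g • F, hF.smul_set, fun s hs => ?_⟩
    obtain ⟨h, hh, f, hf, h'⟩ := hS (Set.smul_mem_smul_set hs)
    refine ⟨_, ⟨h, hh, rfl⟩, _, Set.smul_mem_smul_set hf, ?_⟩
    simp only [smul_eq_mul] at h'
    simp [mul_assoc, h']

theorem relIndex_ne_zero_of_finiteOver (h : FiniteOver H (K : Set G)) : H.relIndex K ≠ 0 := by
  obtain ⟨F, hF, hK⟩ := h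
  -- inverses turn the right cosets of `H` that cover `K` into left cosets
  have key : ∀ k : K, ∃ f : F, ∃ x ∈ H, x * f = (k : G)⁻¹ := fun k => by
    obtain ⟨x, hx, f, hf, h⟩ := hK (K.inv_mem k.2)
    exact ⟨⟨f, hf⟩, x, hx, h⟩
  choose c x hx hc using key
  have := hF.to_subtype
  have inj : Function.Injective fun q : K ⧸ H.subgroupOf K => c q.out := by
    intro p q hpq
    rw [← QuotientGroup.out_eq' p, ← QuotientGroup.out_eq' q, QuotientGroup.eq,
      Subgroup.mem_subgroupOf]
    have hp := hc p.out
    have hq := hc q.out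
    dsimp only at hpq
    rw [hpq] at hp
    have : ((p.out⁻¹ * q.out : K) : G) = x p.out * (x q.out)⁻¹ := by
      rw [Subgroup.coe_mul, Subgroup.coe_inv, ← hp, ← inv_inv (q.out : G), ← hq]
      group
    rw [this]
    exact H.mul_mem (hx _) (H.inv_mem (hx _))
  have := Finite.of_injective _ inj
  exact (Subgroup.finiteIndex_of_finite_quotient (H := H.subgroupOf K)).index_ne_zero

end FiniteOver

section AlmostInvariant

variable {G : Type*} [Group G] {H K : Subgroup G} {S T U V W X : Set G}

theorem IsAlmostInvariant.mul_mem_iff (hX : IsAlmostInvariant H X) {h x : G} (hh : h ∈ H) :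
    h * x ∈ X ↔ x ∈ X := by
  conv_lhs => rw [← hX.1 h hh]
  exact Set.smul_mem_smul_set_iff

/-- The boundary of an almost invariant set `X` in any direction `s` is finite modulo `H`. -/
theorem IsAlmostInvariant.finiteOver_boundary (hX : IsAlmostInvariant H X) (s : G) :
    FiniteOver H {g | ¬ (g * s ∈ X ↔ g ∈ X)} := by
  refine (hX.2 s⁻¹).mono fun g hg => ?_
  rw [Set.mem_symmDiff]
  have : g ∈ X * {s⁻¹} ↔ g * s ∈ X := by
    simp
  rw [this]
  simp only [Set.mem_ofPred_eq] at hg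
  tauto

theorem IsAlmostInvariant.finiteOver_boundary_finite (hX : IsAlmostInvariant H X) (hS : S.Finite) :
    ∃ F : Set G, F.Finite ∧ ∀ g, ∀ s ∈ S, ¬ (g * s ∈ X ↔ g ∈ X) → g ∈ (H : Set G) * F := by
  obtain ⟨F, hF, h⟩ := FiniteOver.biUnion hS fun s _ => hX.finiteOver_boundary s
  exact ⟨F, hF, fun g s hs hg => h (Set.mem_biUnion hs hg)⟩

theorem IsAlmostInvariant.compl (hX : IsAlmostInvariant H X) : IsAlmostInvariant H Xᶜ := by
  refine ⟨fun h hh => by rw [Set.smul_set_compl, hX.1 h hh], fun g => (hX.2 g).mono ?_⟩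
  intro x
  simp only [Set.mem_symmDiff, Set.mul_singleton, Set.image_mul_right, Set.mem_preimage,
    Set.mem_compl_iff]
  tauto

theorem IsNontrivialAlmostInvariant.compl (hX : IsNontrivialAlmostInvariant H X) :
    IsNontrivialAlmostInvariant H Xᶜ :=
  ⟨hX.1.compl, hX.2.2, by rw [compl_compl]; exact hX.2.1⟩

theorem exists_mem_of_not_finiteOver (h : ¬ FiniteOver H S) (hT : FiniteOver H T) :
    ∃ x ∈ S, x ∉ T := by
  by_contra! h'
  exact h (hT.mono h')

theorem IsNontrivialAlmostInvariant.nonempty (hX : IsNontrivialAlmostInvariant H X) :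
    X.Nonempty :=
  let ⟨x, hx, _⟩ := exists_mem_of_not_finiteOver hX.2.1 FiniteOver.empty
  ⟨x, hx⟩

theorem IsAlmostInvariant.le_stabilizer (hX : IsAlmostInvariant H X) :
    H ≤ MulAction.stabilizer G X := fun h hh => hX.1 h hh

/-- The stabilizer `K` of `X` is `H`-finite: for `x ∈ X` and `x s ∉ X`, all of `K x` lies in the
boundary of `X` in the direction `s`. -/
theorem IsNontrivialAlmostInvariant.finiteOver_stabilizer
    (hX : IsNontrivialAlmostInvariant H X) :
    FiniteOver H (MulAction.stabilizer G X : Set G) := by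
  obtain ⟨x, hx⟩ := hX.nonempty
  obtain ⟨y, hy⟩ := hX.compl.nonempty
  refine ((hX.1.finiteOver_boundary (x⁻¹ * y)).mul_finite (Set.finite_singleton x⁻¹)).mono ?_
  intro k hk
  have hk' : ∀ z, k * z ∈ X ↔ z ∈ X := fun z => by
    conv_lhs => rw [← MulAction.mem_stabilizer_iff.1 hk]
    exact Set.smul_mem_smul_set_iff
  refine ⟨k * x, ?_, x⁻¹, rfl, by simp⟩
  rw [Set.mem_ofPred_eq, mul_assoc, hk', hk', mul_inv_cancel_left]
  intro h
  exact hy (h.2 hx)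

theorem IsNontrivialAlmostInvariant.finiteOver_stabilizer_iff
    (hX : IsNontrivialAlmostInvariant H X) :
    FiniteOver (MulAction.stabilizer G X) S ↔ FiniteOver H S :=
  ⟨fun h => h.of_finiteOver_subgroup hX.finiteOver_stabilizer,
    fun h => h.of_subgroup_le hX.1.le_stabilizer⟩

theorem IsNontrivialAlmostInvariant.of_stabilizer (hX : IsNontrivialAlmostInvariant H X) :
    IsNontrivialAlmostInvariant (MulAction.stabilizer G X) X :=
  ⟨⟨fun _ h => h, fun g => hX.finiteOver_stabilizer_iff.2 (hX.1.2 g)⟩,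
    fun h => hX.2.1 (hX.finiteOver_stabilizer_iff.1 h),
    fun h => hX.2.2 (hX.finiteOver_stabilizer_iff.1 h)⟩

end AlmostInvariant

/-- Smallness of a corner of two almost invariant sets does not depend on which of the two
subgroups is used. -/
theorem FiniteOver.symm {G : Type*} [Group G] {H K : Subgroup G} {U V : Set G}
    (hU : ¬ FiniteOver H U) (hUi : IsAlmostInvariant H U) (hV : IsAlmostInvariant K V)
    (h : FiniteOver H (U ∩ V)) : FiniteOver K (U ∩ V) := by
  obtain ⟨F, hF, hS⟩ := h
  obtain ⟨x, hx, hxF⟩ := exists_mem_of_not_finiteOver hU ⟨F, hF, subset_rfl⟩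
  -- right multiplication by `f⁻¹ x` carries a point `h f` of the corner out of it, but not out
  -- of `U`, hence out of `V`
  obtain ⟨F', hF', hb⟩ := hV.finiteOver_boundary_finite (hF.inv.mul (Set.finite_singleton x))
  refine ⟨F', hF', ?_⟩
  rintro y ⟨hyU, hyV⟩
  obtain ⟨k, hk, f, hf, hkf⟩ := hS ⟨hyU, hyV⟩
  refine hb y (f⁻¹ * x) ⟨f⁻¹, Set.inv_mem_inv.2 hf, x, rfl, rfl⟩ fun hiff => hxF ?_
  have hy : y * (f⁻¹ * x) = k * x := by rw [← hkf]; group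
  have h1 : k * x ∈ U ∩ V := ⟨(hUi.mul_mem_iff hk).2 hx, hy ▸ hiff.2 hyV⟩
  obtain ⟨k', hk', f', hf', h2⟩ := hS h1
  exact ⟨k⁻¹ * k', H.mul_mem (H.inv_mem hk) hk', f', hf', by
    simp only at h2 ⊢; rw [mul_assoc, h2, inv_mul_cancel_left]⟩

end AlmostInvariant

/-! ### The order on almost invariant sets -/

namespace AlmostInvariant

section Order

variable {G : Type*} [Group G] {U V W : Set G}

/-- A set that is a non-trivial almost invariant set over its own stabilizer. -/
def Essential (U : Set G) : Prop :=
  IsNontrivialAlmostInvariant (MulAction.stabilizer G U) U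

/-- `U` is almost contained in `V`: the corner `U ∩ Vᶜ` is small, that is, finite over the stabilizer
of `U`. -/
def AlmostLE (U V : Set G) : Prop :=
  FiniteOver (MulAction.stabilizer G U) (U ∩ Vᶜ)

/-- The order `U ≤ V`: the corner `U ∩ Vᶜ` is empty, or it is the only small one. For non-trivial
sets the only other corner that can be small together with `U ∩ Vᶜ` is `V ∩ Uᶜ`. -/
def CornerLE (U V : Set G) : Prop :=
  AlmostLE U V ∧ (AlmostLE V U → U ⊆ V)

theorem Essential.compl (hU : Essential U) : Essential Uᶜ := by
  rw [Essential, stabilizer_compl]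
  exact IsNontrivialAlmostInvariant.compl hU

theorem Essential.smul (hU : Essential U) (g : G) : Essential (g • U) := by
  have hs : MulAction.stabilizer G (g • U) = MulAut.conj g • MulAction.stabilizer G U :=
    MulAction.stabilizer_smul_eq_stabilizer_map_conj g U
  refine ⟨⟨fun _ h => h, fun x => ?_⟩, ?_, ?_⟩
  · rw [AlmostEqual, hs, finiteOver_conj, Set.smul_set_symmDiff]
    rw [smul_mul_assoc, inv_smul_smul, inv_smul_smul]
    exact hU.1.2 x
  · rw [hs, finiteOver_conj, inv_smul_smul]
    exact hU.2.1
  · rw [hs, finiteOver_conj, ← Set.smul_set_compl, inv_smul_smul]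
    exact hU.2.2

theorem AlmostLE.of_subset (h : U ⊆ V) : AlmostLE U V :=
  FiniteOver.empty.mono fun _ hx => hx.2 (h hx.1)

theorem AlmostLE.finiteOver (hU : Essential U) (hV : Essential V) (h : AlmostLE U V) :
    FiniteOver (MulAction.stabilizer G V) (U ∩ Vᶜ) :=
  FiniteOver.symm hU.2.1 hU.1 hV.1.compl h

theorem AlmostLE.compl (hU : Essential U) (hV : Essential V) (h : AlmostLE U V) :
    AlmostLE Vᶜ Uᶜ := by
  rw [AlmostLE, stabilizer_compl, compl_compl, Set.inter_comm]
  exact h.finiteOver hU hV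

theorem AlmostLE.smul (h : AlmostLE U V) (g : G) : AlmostLE (g • U) (g • V) := by
  rw [AlmostLE, MulAction.stabilizer_smul_eq_stabilizer_map_conj]
  refine (finiteOver_conj g).2 ?_
  rwa [Set.smul_set_inter, inv_smul_smul, ← Set.smul_set_compl, inv_smul_smul]

/-- The points of `U ∩ V ∩ Wᶜ` can be moved into `Vᶜ` by right multiplication by elements of a
finite set, so that they are close to the boundary of `U` or to the small corner `U ∩ Vᶜ`. -/
theorem AlmostLE.trans (hU : Essential U) (hV : Essential V) (hUV : AlmostLE U V)
    (hVW : AlmostLE V W) : AlmostLE U W := by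
  obtain ⟨F, hF, hS⟩ := hVW
  obtain ⟨v, hv⟩ := hV.compl.nonempty
  have hT : (F⁻¹ * {v}).Finite := hF.inv.mul (Set.finite_singleton v)
  obtain ⟨F', hF', hb⟩ := hU.1.finiteOver_boundary_finite hT
  refine (FiniteOver.union (FiniteOver.union hUV (hUV.mul_finite hT.inv)) ⟨F', hF', subset_rfl⟩).mono
    fun p ⟨hpU, hpW⟩ => ?_
  by_cases hpV : p ∈ V
  · obtain ⟨h, hh, f, hf, hp⟩ := hS ⟨hpV, hpW⟩
    have hs : f⁻¹ * v ∈ F⁻¹ * {v} := ⟨f⁻¹, Set.inv_mem_inv.2 hf, v, rfl, rfl⟩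
    have hpv : p * (f⁻¹ * v) ∉ V := by
      rw [← hp]
      simp only [mul_assoc, mul_inv_cancel_left]
      exact fun h' => hv ((hV.1.mul_mem_iff hh).1 h')
    by_cases hpU' : p * (f⁻¹ * v) ∈ U
    · exact Or.inl (Or.inr ⟨_, ⟨hpU', hpv⟩, _, Set.inv_mem_inv.2 hs, by group⟩)
    · exact Or.inr (hb p _ hs (by tauto))
  · exact Or.inl (Or.inl ⟨hpU, hpV⟩)

theorem not_almostLE_compl (hU : Essential U) (h : AlmostLE U V) : ¬ AlmostLE U Vᶜ := fun h' =>
  hU.2.1 ((FiniteOver.union h h').mono fun x hx => by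
    by_cases hxV : x ∈ V
    · exact Or.inr ⟨hx, by simpa using hxV⟩
    · exact Or.inl ⟨hx, hxV⟩)

theorem CornerLE.of_subset (h : U ⊆ V) : CornerLE U V := ⟨.of_subset h, fun _ => h⟩

theorem CornerLE.trans (hU : Essential U) (hV : Essential V) (hW : Essential W)
    (hUV : CornerLE U V) (hVW : CornerLE V W) : CornerLE U W :=
  ⟨hUV.1.trans hU hV hVW.1, fun h =>
    (hUV.2 (hVW.1.trans hV hW h)).trans (hVW.2 (h.trans hW hU hUV.1))⟩

theorem CornerLE.antisymm (hUV : CornerLE U V) (hVU : CornerLE V U) : U = V :=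
  (hUV.2 hVU.1).antisymm (hVU.2 hUV.1)

theorem CornerLE.compl (hU : Essential U) (hV : Essential V) (h : CornerLE U V) :
    CornerLE Vᶜ Uᶜ :=
  ⟨h.1.compl hU hV, fun h' => Set.compl_subset_compl.2 (h.2 (by
    simpa using h'.compl hU.compl hV.compl))⟩

theorem CornerLE.smul (h : CornerLE U V) (g : G) : CornerLE (g • U) (g • V) :=
  ⟨h.1.smul g, fun h' => Set.smul_set_mono (h.2 (by simpa using h'.smul g⁻¹))⟩

/-- If two of the corners of `U` and `V` are small only if one of them is empty, then almost
inclusions can be replaced by relations of the order. -/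
theorem AlmostLE.cornerLE_or (h : AlmostLE U V) (h' : AlmostLE V U → U ⊆ V ∨ V ⊆ U) :
    CornerLE U V ∨ CornerLE V U := by
  by_cases hVU : AlmostLE V U
  · exact (h' hVU).imp .of_subset .of_subset
  · exact Or.inl ⟨h, fun h'' => absurd h'' hVU⟩

end Order

section Deep

variable {G : Type*} [Group G] {H K : Subgroup G} {U X : Set G}

/-- A finite union of cosets of a finitely generated subgroup is connected in the Cayley graph of
`G` with respect to a suitable finite set of elements. -/
theorem exists_finite_connecting (hH : H.FG) {F : Set G} (hF : F.Finite) :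
    ∃ S : Set G, S.Finite ∧ ∀ W : Set G,
      (∀ n ∈ (H : Set G) * F, ∀ s ∈ S, (n * s ∈ W ↔ n ∈ W)) →
        (H : Set G) * F ⊆ W ∨ (H : Set G) * F ⊆ Wᶜ := by
  obtain ⟨T, hT, hTf⟩ := (Subgroup.fg_iff H).1 hH
  refine ⟨F⁻¹ * (T ∪ {1}) * F, (hF.inv.mul (hTf.union (Set.finite_singleton 1))).mul hF, ?_⟩
  intro W hW
  have step : ∀ h ∈ H, ∀ f ∈ F, ∀ f' ∈ F, ∀ t ∈ T ∪ {1}, (h * t * f' ∈ W ↔ h * f ∈ W) := by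
    intro h hh f hf f' hf' t ht
    rw [← hW (h * f) ⟨h, hh, f, hf, rfl⟩ (f⁻¹ * t * f')
      ⟨_, ⟨_, Set.inv_mem_inv.2 hf, t, ht, rfl⟩, f', hf', rfl⟩]
    rw [show h * f * (f⁻¹ * t * f') = h * t * f' by group]
  have hTH : T ⊆ H := hT ▸ Subgroup.subset_closure
  have key : ∀ h ∈ H, ∀ f ∈ F, ∀ f' ∈ F, (h * f' ∈ W ↔ f ∈ W) := by
    intro h hh
    rw [← hT] at hh
    induction hh using Subgroup.closure_induction_right with
    | one => intro f hf f' hf'; simpa using step 1 H.one_mem f hf f' hf' 1 (Or.inr rfl)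
    | mul_right x hx y hy ih =>
      intro f hf f' hf'
      exact (step x (hT ▸ hx) f hf f' hf' y (Or.inl hy)).trans (ih f hf f hf)
    | mul_inv_cancel x hx y hy ih =>
      intro f hf f' hf'
      have := step (x * y⁻¹) (H.mul_mem (hT ▸ hx) (H.inv_mem (hTH hy))) f' hf' f hf y (Or.inl hy)
      rw [inv_mul_cancel_right] at this
      rw [← this]
      exact ih f hf f hf
  by_cases hne : ∃ f ∈ F, f ∈ W
  · obtain ⟨f, hf, hfW⟩ := hne
    left
    rintro _ ⟨h, hh, f', hf', rfl⟩
    exact (key h hh f hf f' hf').2 hfW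
  · right
    rintro _ ⟨h, hh, f', hf', rfl⟩
    exact fun h' => hne ⟨f', hf', (key h hh f' hf' f' hf').1 h'⟩

theorem eq_univ_of_forall_mul_mem_iff {S : Set G} (hS : Subgroup.closure S = ⊤) {W : Set G}
    (hW : ∀ g, ∀ s ∈ S, (g * s ∈ W ↔ g ∈ W)) : W = ∅ ∨ W = Set.univ := by
  have key : ∀ h g, (g * h ∈ W ↔ g ∈ W) := by
    intro h
    have hh : h ∈ Subgroup.closure S := hS ▸ Subgroup.mem_top h
    induction hh using Subgroup.closure_induction_right with
    | one => simp
    | mul_right x hx y hy ih => intro g; rw [← mul_assoc, hW _ y hy, ih]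
    | mul_inv_cancel x hx y hy ih =>
      intro g
      rw [← mul_assoc, ← hW _ y hy, inv_mul_cancel_right, ih]
  rcases W.eq_empty_or_nonempty with h | ⟨w, hw⟩
  · exact Or.inl h
  · refine Or.inr (Set.eq_univ_of_forall fun g => ?_)
    have := key (w⁻¹ * g) w
    rw [mul_inv_cancel_left] at this
    exact this.2 hw

/-- Only finitely many translates of `X` modulo the action of `H` fail to be nested with `U`.
If the connected neighbourhoods of the boundaries of `U` and `g X` are disjoint, then each of them
lies on one side of the other set, and the opposite corner has no boundary. -/
theorem exists_finite_not_nested [Group.FG G] (hH : H.FG) (hK : K.FG)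
    (hU : IsAlmostInvariant H U) (hX : IsAlmostInvariant K X)
    (hUne : U.Nonempty) (hUne' : Uᶜ.Nonempty) :
    ∃ C : Set G, C.Finite ∧ ∀ g : G, (∃ a b, corner U (g • X) a b = ∅) ∨
      g ∈ (H : Set G) * C * (K : Set G) := by
  obtain ⟨S, hS, hSf⟩ := (Subgroup.fg_iff _).1 (Group.FG.out : (⊤ : Subgroup G).FG)
  obtain ⟨F₁, hF₁, hb₁⟩ := hU.finiteOver_boundary_finite hSf
  obtain ⟨F₂, hF₂, hb₂⟩ := hX.finiteOver_boundary_finite hSf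
  obtain ⟨S₁, hS₁, hc₁⟩ := exists_finite_connecting hH hF₁
  obtain ⟨S₂, hS₂, hc₂⟩ := exists_finite_connecting hK hF₂
  obtain ⟨F₃, hF₃, hb₃⟩ := hX.finiteOver_boundary_finite hS₁
  obtain ⟨F₄, hF₄, hb₄⟩ := hU.finiteOver_boundary_finite hS₂
  refine ⟨(F₁ ∪ F₄) * (F₂ ∪ F₃)⁻¹, (hF₁.union hF₄).mul (hF₂.union hF₃).inv, fun g => ?_⟩
  by_contra! hcon
  obtain ⟨hne, hg⟩ := hcon
  have hdisj : ∀ x ∈ (H : Set G) * (F₁ ∪ F₄), g⁻¹ * x ∉ (K : Set G) * (F₂ ∪ F₃) := by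
    rintro _ ⟨h, hh, f, hf, rfl⟩ ⟨k, hk, f', hf', h'⟩
    refine hg ⟨h * (f * f'⁻¹), ⟨h, hh, _, ⟨f, hf, _, Set.inv_mem_inv.2 hf', rfl⟩, rfl⟩,
      k⁻¹, K.inv_mem hk, ?_⟩
    simp only at h' ⊢
    have : h * f = g * (k * f') := by rw [h']; group
    rw [← mul_assoc, this]
    group
  have mem_gX : ∀ x, x ∈ g • X ↔ g⁻¹ * x ∈ X := fun x => Set.mem_smul_set_iff_inv_smul_mem
  -- the neighbourhood of the boundary of `U` lies on one side of `g X`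
  have h1 : ∃ b, (H : Set G) * F₁ ⊆ side (g • X) b := by
    rcases hc₁ (g • X) fun n hn s hs => by
      by_contra hcon
      rw [mem_gX, mem_gX, ← mul_assoc] at hcon
      exact hdisj n (Set.mul_subset_mul_left Set.subset_union_left hn)
        (Set.mul_subset_mul_left Set.subset_union_right (hb₃ _ s hs hcon)) with h | h
    exacts [⟨true, h⟩, ⟨false, h⟩]
  -- and the one of the boundary of `g X` lies on one side of `U`
  have h2 : ∃ a, ∀ x, g⁻¹ * x ∈ (K : Set G) * F₂ → x ∈ side U a := by
    rcases hc₂ (g⁻¹ • U) fun n hn s hs => by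
      by_contra hcon
      rw [Set.mem_smul_set_iff_inv_smul_mem, Set.mem_smul_set_iff_inv_smul_mem, inv_inv,
        smul_eq_mul, smul_eq_mul, ← mul_assoc] at hcon
      refine hdisj (g * n) (Set.mul_subset_mul_left Set.subset_union_right (hb₄ _ s hs hcon)) ?_
      rw [inv_mul_cancel_left]
      exact Set.mul_subset_mul_left Set.subset_union_left hn with h | h
    · refine ⟨true, fun x hx => ?_⟩
      simpa [Set.mem_smul_set_iff_inv_smul_mem, side] using h hx
    · refine ⟨false, fun x hx => ?_⟩
      have := h hx
      simpa [Set.mem_smul_set_iff_inv_smul_mem, side] using this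
  obtain ⟨b, hb⟩ := h1
  obtain ⟨a, ha⟩ := h2
  have side_not : ∀ (Y : Set G) (c : Bool) (x : G), x ∈ side Y (!c) ↔ x ∉ side Y c := by
    rintro Y (_ | _) x <;> simp [side]
  have side_iff : ∀ (Y : Set G) (c : Bool) (x y : G), ¬ (x ∈ side Y c ↔ y ∈ side Y c) →
      ¬ (x ∈ Y ↔ y ∈ Y) := by
    rintro Y (_ | _) x y <;> (simp [side]; try tauto)
  have hcorner : ∀ x, ∀ s ∈ S, (x * s ∈ corner U (g • X) (!a) (!b) ↔
      x ∈ corner U (g • X) (!a) (!b)) := by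
    intro x s hs
    by_contra hcon
    simp only [corner, Set.mem_inter_iff, side_not] at hcon
    by_cases hxU : (x * s ∈ side U a ↔ x ∈ side U a)
    · have hxX : ¬ (x * s ∈ side (g • X) b ↔ x ∈ side (g • X) b) := by tauto
      have := side_iff _ _ _ _ hxX
      rw [mem_gX, mem_gX, ← mul_assoc] at this
      have := ha x (hb₂ _ s hs this)
      tauto
    · have := hb (hb₁ x s hs (side_iff _ _ _ _ hxU))
      by_cases hxX : (x * s ∈ side (g • X) b ↔ x ∈ side (g • X) b)
      · tauto
      · have h3 := side_iff _ _ _ _ hxX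
        rw [mem_gX, mem_gX, ← mul_assoc] at h3
        refine hdisj x (Set.mul_subset_mul_left Set.subset_union_left
          (hb₁ x s hs (side_iff _ _ _ _ hxU))) ?_
        exact Set.mul_subset_mul_left Set.subset_union_left (hb₂ _ s hs h3)
  rcases eq_univ_of_forall_mul_mem_iff hS hcorner with h | h
  · exact (hne (!a) (!b)).ne_empty h
  · have hall : ∀ x, x ∉ side U a := fun x => by
      have hx : x ∈ corner U (g • X) (!a) (!b) := h ▸ Set.mem_univ x
      exact (side_not _ _ _).1 hx.1
    cases a
    · exact hall _ hUne'.some_mem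
    · exact hall _ hUne.some_mem

end Deep

end AlmostInvariant

/-! ### Ordered sets of oriented edges of a tree -/

namespace AlmostInvariant

/-- The axioms of the set `P` of oriented edges of a tree, ordered by `p ≤ q` if some path without
backtracking starts with `p` and ends with `q`, on which `G` acts without inversions. The map `star`
reverses edges. The `G`-orbits of geometric edges are indexed by `color`, `positive` is a
`G`-invariant orientation, and `edge i` is a chosen positive edge of color `i`. -/
structure TreeOrder (G ι P : Type*) [Group G] [PartialOrder P] [MulAction G P] where
  star : P → P
  star_star : ∀ p, star (star p) = p
  star_le_star : ∀ {p q}, p ≤ q → star q ≤ star p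
  not_le_star : ∀ {p q}, p ≤ q → ¬ p ≤ star q
  nested : ∀ p q, p ≤ q ∨ p ≤ star q ∨ star p ≤ q ∨ q ≤ p
  finite_Ioo : ∀ p q : P, (Set.Ioo p q).Finite
  smul_le_smul : ∀ (g : G) {p q : P}, p ≤ q → g • p ≤ g • q
  smul_star : ∀ (g : G) p, g • star p = star (g • p)
  color : P → ι
  positive : P → Bool
  edge : ι → P
  color_star : ∀ p, color (star p) = color p
  color_smul : ∀ (g : G) p, color (g • p) = color p
  color_edge : ∀ i, color (edge i) = i
  positive_star : ∀ p, positive (star p) = !positive p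
  positive_smul : ∀ (g : G) p, positive (g • p) = positive p
  positive_edge : ∀ i, positive (edge i) = true
  exists_smul_edge : ∀ p, positive p = true → ∃ g : G, p = g • edge (color p)

namespace TreeOrder

variable {G ι P : Type*} [Group G] [PartialOrder P] [MulAction G P] (T : TreeOrder G ι P)
  {p q r : P} {i : ι}

theorem star_le_comm : T.star p ≤ q ↔ T.star q ≤ p :=
  ⟨fun h => by simpa [T.star_star] using T.star_le_star h,
    fun h => by simpa [T.star_star] using T.star_le_star h⟩

theorem le_star_comm : p ≤ T.star q ↔ q ≤ T.star p :=
  ⟨fun h => by simpa [T.star_star] using T.star_le_star h,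
    fun h => by simpa [T.star_star] using T.star_le_star h⟩

theorem star_inj : T.star p = T.star q ↔ p = q :=
  ⟨fun h => by rw [← T.star_star p, h, T.star_star], fun h => h ▸ rfl⟩

theorem star_lt_star (h : p < q) : T.star q < T.star p :=
  (T.star_le_star h.le).lt_of_ne fun h' => h.ne ((T.star_inj.1 h').symm)

theorem lt_star_comm : p < T.star q ↔ q < T.star p :=
  ⟨fun h => by simpa [T.star_star] using T.star_lt_star h,
    fun h => by simpa [T.star_star] using T.star_lt_star h⟩

theorem star_lt_comm : T.star p < q ↔ T.star q < p :=
  ⟨fun h => by simpa [T.star_star] using T.star_lt_star h,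
    fun h => by simpa [T.star_star] using T.star_lt_star h⟩

theorem not_star_le (h : p ≤ q) : ¬ T.star p ≤ q := fun h' =>
  T.not_le_star (T.star_le_star h) (by rw [T.star_star]; exact (T.star_le_comm.1 h'))

theorem not_le_star_self : ¬ p ≤ T.star p := T.not_le_star le_rfl

theorem not_star_le_self : ¬ T.star p ≤ p := T.not_star_le le_rfl

theorem smul_le_smul_iff (T : TreeOrder G ι P) (g : G) : g • p ≤ g • q ↔ p ≤ q :=
  ⟨fun h => by simpa using T.smul_le_smul g⁻¹ h, T.smul_le_smul g⟩

theorem smul_lt_smul_iff (T : TreeOrder G ι P) (g : G) : g • p < g • q ↔ p < q := by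
  rw [lt_iff_le_not_ge, lt_iff_le_not_ge, T.smul_le_smul_iff, T.smul_le_smul_iff]

theorem smul_ne_star (g : G) : g • p ≠ T.star p := fun h => by
  have := congrArg T.positive h
  rw [T.positive_smul, T.positive_star] at this
  cases h : T.positive p <;> simp [h] at this

theorem star_ne_smul (g : G) : T.star p ≠ g • p := (T.smul_ne_star g).symm

/-- The head of the edge `p`, as the set of all edges that point towards it. Two edges have the same
head if these sets agree, so no quotient of `P` is needed to define the vertices. -/
def head (p : P) : Set P := {q | q ≤ p ∨ q < T.star p}

theorem mem_head : q ∈ T.head p ↔ q ≤ p ∨ q < T.star p := Iff.rfl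

theorem self_mem_head : p ∈ T.head p := Or.inl le_rfl

theorem star_notMem_head : T.star p ∉ T.head p := by
  rintro (h | h)
  · exact T.not_star_le_self h
  · exact h.false

theorem head_smul (g : G) : T.head (g • p) = g • T.head p := by
  ext q
  rw [Set.mem_smul_set_iff_inv_smul_mem, mem_head, mem_head,
    ← T.smul_le_smul_iff g (p := g⁻¹ • q), ← T.smul_lt_smul_iff g (p := g⁻¹ • q), smul_inv_smul,
    T.smul_star]

/-- The two ends of `p` differ only in the edges `p` and `star p`. -/
theorem mem_head_star (h1 : q ≠ p) (h2 : q ≠ T.star p) :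
    q ∈ T.head (T.star p) ↔ q ∈ T.head p := by
  rw [mem_head, mem_head, T.star_star, le_iff_lt_or_eq, le_iff_lt_or_eq]
  tauto

/-- If `p` and `q` point towards the heads of each other, in particular if they have the same head,
then they are equal or the path from `p` to the reverse of `q` starts with `p`. -/
theorem eq_or_lt_star (h1 : p ∈ T.head q) (h2 : q ∈ T.head p) : p = q ∨ p < T.star q := by
  rcases h1 with h1 | h1
  · rcases h2 with h2 | h2
    · exact Or.inl (le_antisymm h1 h2)
    · exact Or.inr (T.lt_star_comm.1 h2)
  · exact Or.inr h1

/-- If no edge lies between `p` and `q`, then `q` starts where `p` ends. -/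
theorem head_eq_of_Ioo_eq_empty (hpq : p < q) (h : Set.Ioo p q = ∅) :
    T.head p = T.head (T.star q) := by
  have key : ∀ {a b : P}, a < T.star b → Set.Ioo a (T.star b) = ∅ → T.head a ⊆ T.head b := by
    intro a b hab h r hr
    rcases hr with hr | hr
    · exact Or.inr (hr.trans_lt hab)
    · have hra : a < T.star r := T.lt_star_comm.1 hr
      rcases T.nested r b with h1 | h1 | h1 | h1
      · exact Or.inl h1
      · refine Or.inr (h1.lt_of_ne ?_)
        rintro rfl
        exact T.not_le_star_self (hab.trans hr).le
      · exact absurd (T.star_le_comm.1 h1) fun h2 => T.not_le_star_self ((hab.trans_le h2).trans hr).le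
      · rcases h1.eq_or_lt with rfl | h1
        · exact Or.inl le_rfl
        · exact absurd (show T.star r ∈ Set.Ioo a (T.star b) from ⟨hra, T.star_lt_star h1⟩)
            (h ▸ Set.notMem_empty _)
  refine (key (by rwa [T.star_star]) (by rwa [T.star_star])).antisymm
    (key (T.star_lt_star hpq) ?_)
  rw [Set.eq_empty_iff_forall_notMem] at h ⊢
  exact fun r hr => h (T.star r) ⟨T.lt_star_comm.1 hr.2, T.star_lt_comm.1 hr.1⟩

/-- A relation between vertices that holds along the edges of `S` joins the head of `p` to the tail
of `q` if `p < q` and all edges between `p` and `q` are in `S`. -/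
theorem rel_head_head_star {R : Set P → Set P → Prop} (hR : Equivalence R) {S : Set P}
    (hS : ∀ e ∈ S, R (T.head (T.star e)) (T.head e)) (n : ℕ) :
    ∀ p q : P, (Set.Ioo p q).ncard = n → p < q → Set.Ioo p q ⊆ S →
      R (T.head p) (T.head (T.star q)) := by
  induction n using Nat.strong_induction_on with
  | h n ih =>
    intro p q hn hpq hIoo
    by_cases h : Set.Ioo p q = ∅
    · rw [T.head_eq_of_Ioo_eq_empty hpq h]
      exact hR.refl _
    · obtain ⟨r, hr⟩ := Set.nonempty_iff_ne_empty.2 h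
      have h1 : Set.Ioo p r ⊂ Set.Ioo p q :=
        ⟨Set.Ioo_subset_Ioo_right hr.2.le, fun h => (h hr).2.false⟩
      have h2 : Set.Ioo r q ⊂ Set.Ioo p q :=
        ⟨Set.Ioo_subset_Ioo_left hr.1.le, fun h => (h hr).1.false⟩
      have hfin := T.finite_Ioo p q
      refine hR.trans (hR.trans (ih _ (hn ▸ Set.ncard_lt_ncard h1 hfin) p r rfl hr.1
        (h1.subset.trans hIoo)) (hS r (hIoo hr))) (ih _ (hn ▸ Set.ncard_lt_ncard h2 hfin) r q rfl hr.2
        (h2.subset.trans hIoo))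

/-- Two vertices are joined by a path through `S` if every edge separating them is in `S`. -/
theorem rel_head_head {R : Set P → Set P → Prop} (hR : Equivalence R) {S : Set P}
    (hS : ∀ e ∈ S, R (T.head (T.star e)) (T.head e))
    (h : ∀ e, e ∈ T.head q → e ∉ T.head p → e ∈ S) : R (T.head p) (T.head q) := by
  -- the path from the head of `p` to the head of `q` if it ends with `q` and extends `p`
  have main : ∀ {p q : P}, p < q → (∀ e, e ∈ T.head q → e ∉ T.head p → e ∈ S ∨ T.star e ∈ S) →
      R (T.head p) (T.head q) := by
    intro p q hpq h
    have hnot : ∀ e, p < e → e ∉ T.head p := by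
      rintro e he (h' | h')
      · exact (he.trans_le h').false
      · exact T.not_le_star_self (he.trans h').le
    have hS' : ∀ e ∈ {e | e ∈ S ∨ T.star e ∈ S}, R (T.head (T.star e)) (T.head e) := by
      rintro e (he | he)
      · exact hS e he
      · have := hS _ he
        rw [T.star_star] at this
        exact hR.symm this
    exact hR.trans (T.rel_head_head_star hR hS' _ p q rfl hpq fun e he =>
      h e (Or.inl he.2.le) (hnot e he.1)) (hS' q (h q T.self_mem_head (hnot q hpq)))
  -- each edge or its reverse points towards a given vertex, but not both
  have compl : ∀ e a, T.star e ∈ T.head a ↔ e ∉ T.head a := by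
    intro e a
    constructor
    · rintro (h1 | h1) (h2 | h2)
      · exact T.not_star_le h2 h1
      · exact (h1.trans_lt (T.lt_star_comm.1 h2)).false
      · exact (h1.trans_le (T.star_le_star h2)).false
      · exact T.not_star_le h2.le h1.le
    · intro h'
      rw [mem_head, not_or] at h'
      rcases T.nested e a with h1 | h1 | h1 | h1
      · exact absurd h1 h'.1
      · rcases h1.eq_or_lt with rfl | h1
        · rw [T.star_star]; exact T.self_mem_head
        · exact absurd h1 h'.2
      · exact Or.inl h1
      · rcases h1.eq_or_lt with rfl | h1
        · exact absurd le_rfl h'.1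
        · exact Or.inr (T.star_lt_star h1)
  by_cases hpq : p = q
  · rw [hpq]; exact hR.refl _
  by_cases hpq' : q = T.star p
  · subst hpq'
    have := hS _ (h _ T.self_mem_head T.star_notMem_head)
    rwa [T.star_star] at this
  rcases T.nested p q with h1 | h1 | h1 | h1
  · exact main (h1.lt_of_ne hpq) fun e he he' => Or.inl (h e he he')
  · have h2 : p < T.star q := h1.lt_of_ne fun h' => hpq' (by rw [h', T.star_star])
    refine T.rel_head_head_star hR hS _ p (T.star q) rfl h2 (fun e he => h e (Or.inr he.2) ?_)
      |> fun h3 => by rwa [T.star_star] at h3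
    rintro (h' | h')
    · exact (he.1.trans_le h').false
    · exact T.not_le_star_self (he.1.trans h').le
  · have h2 : T.star p < q := h1.lt_of_ne (Ne.symm hpq')
    have hp : T.star p ∈ S := h _ (Or.inl h1) T.star_notMem_head
    have h3 := hS _ hp
    rw [T.star_star] at h3
    refine hR.trans h3 (main h2 fun e he he' => ?_)
    by_cases hep : e = T.star p
    · exact absurd T.self_mem_head (hep ▸ he')
    by_cases hep' : e = p
    · exact Or.inr (hep' ▸ hp)
    · exact Or.inl (h e he ((T.mem_head_star hep' hep).not.1 he'))
  · refine hR.symm (main (h1.lt_of_ne (Ne.symm hpq)) fun e he he' => Or.inr (h _ ?_ ?_))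
    · exact (compl e q).2 he'
    · rw [compl]; exact fun h' => h' he

/-- The edges of `s` of color `i`. If `s` is a vertex, this is its image in the tree obtained by
collapsing all edges of other colors. -/
def restrict (i : ι) (s : Set P) : Set P := {p ∈ s | T.color p = i}

theorem restrict_smul (g : G) (s : Set P) : T.restrict i (g • s) = g • T.restrict i s := by
  ext p
  simp only [restrict, Set.mem_smul_set_iff_inv_smul_mem, Set.mem_ofPred_eq, T.color_smul]

theorem eq_or_lt_star_of_restrict_eq (hp : T.color p = i) (hq : T.color q = i)
    (h : T.restrict i (T.head p) = T.restrict i (T.head q)) : p = q ∨ p < T.star q := by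
  refine T.eq_or_lt_star ?_ ?_
  · exact (h ▸ ⟨T.self_mem_head, hp⟩ : p ∈ T.restrict i (T.head q)).1
  · exact (h ▸ ⟨T.self_mem_head, hq⟩ : q ∈ T.restrict i (T.head p)).1

theorem restrict_head_star (h : T.color p ≠ i) :
    T.restrict i (T.head (T.star p)) = T.restrict i (T.head p) := by
  ext q
  simp only [restrict, Set.mem_ofPred_eq, and_congr_left_iff]
  intro hq
  refine T.mem_head_star ?_ ?_
  · rintro rfl; exact h hq
  · rintro rfl; exact h (by rwa [T.color_star] at hq)

end TreeOrder

end AlmostInvariant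

/-! ### The quotient graph of groups and its fundamental group -/

namespace AlmostInvariant

theorem GraphOfGroups.IsPath.mono {V E : Type*} {𝒢 : GraphOfGroups V E} {S S' : Set E}
    (hS : S ⊆ S') {v w : V} {x : 𝒢.PathGroup} (h : 𝒢.IsPath S v w x) : 𝒢.IsPath S' v w x := by
  induction h with
  | vertex v g => exact .vertex v g
  | edge e he => exact .edge e (hS he)
  | edge_inv e he => exact .edge_inv e (hS he)
  | comp _ _ hx hy => exact .comp hx hy

namespace TreeOrder

variable {G ι P : Type*} [Group G] [PartialOrder P] [MulAction G P] (T : TreeOrder G ι P)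

/-- The vertices of the tree: the heads of its edges, or a single point if there are no edges. -/
def Vertex : Type _ := {s : Set P // (∃ p, s = T.head p) ∨ IsEmpty P}

namespace Vertex

variable {T}

theorem ext {x y : T.Vertex} (h : x.1 = y.1) : x = y := Subtype.ext h

instance : MulAction G T.Vertex where
  smul g x := ⟨g • x.1, x.2.imp (fun ⟨p, hp⟩ => ⟨g • p, by rw [hp, T.head_smul]⟩) id⟩
  one_smul x := ext (one_smul G x.1)
  mul_smul g h x := ext (mul_smul g h x.1)

theorem coe_smul (g : G) (x : T.Vertex) : (g • x).1 = g • x.1 := rfl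

end Vertex

/-- The vertex at which the edge `p` ends. -/
def headVertex (p : P) : T.Vertex := ⟨T.head p, Or.inl ⟨p, rfl⟩⟩

theorem headVertex_smul (g : G) (p : P) : T.headVertex (g • p) = g • T.headVertex p :=
  Vertex.ext (T.head_smul g)

/-- The vertices of the quotient graph. -/
abbrev Orbit : Type _ := MulAction.orbitRel.Quotient G T.Vertex

/-- The orbit of a vertex. -/
def orbit (x : T.Vertex) : T.Orbit := Quotient.mk _ x

/-- The chosen representative of an orbit of vertices. -/
noncomputable def rep (v : T.Orbit) : T.Vertex := Quotient.out v

theorem orbit_rep (v : T.Orbit) : T.orbit (T.rep v) = v := Quotient.out_eq v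

theorem orbit_smul (g : G) (x : T.Vertex) : T.orbit (g • x) = T.orbit x :=
  Quotient.sound ⟨g, rfl⟩

theorem exists_smul_rep (x : T.Vertex) : ∃ g : G, g • T.rep (T.orbit x) = x :=
  Quotient.exact (s := MulAction.orbitRel G T.Vertex) (T.orbit_rep (T.orbit x)).symm

/-- An element of `G` that carries the chosen representative of the orbit of `x` to `x`. -/
noncomputable def mover (x : T.Vertex) : G := (T.exists_smul_rep x).choose

theorem mover_smul (x : T.Vertex) : T.mover x • T.rep (T.orbit x) = x :=
  (T.exists_smul_rep x).choose_spec

/-- The tail (`true`) or the head (`false`) of the chosen edge of color `i`. -/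
def endpoint (i : ι) : Bool → T.Vertex
  | true => T.headVertex (T.star (T.edge i))
  | false => T.headVertex (T.edge i)

theorem smul_endpoint {i : ι} {g : G} (hg : g ∈ MulAction.stabilizer G (T.edge i)) (b : Bool) :
    g • T.endpoint i b = T.endpoint i b := by
  cases b
  · rw [endpoint, ← headVertex_smul, MulAction.mem_stabilizer_iff.1 hg]
  · rw [endpoint, ← headVertex_smul, T.smul_star, MulAction.mem_stabilizer_iff.1 hg]

/-- The stabilizer of the chosen edge of color `i` fixes its endpoints, and is conjugated into the
stabilizer of the representative of the orbit of either of them. -/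
noncomputable def endpointHom (i : ι) (b : Bool) :
    MulAction.stabilizer G (T.edge i) →* MulAction.stabilizer G (T.rep (T.orbit (T.endpoint i b))) :=
  ((MulAut.conj (T.mover (T.endpoint i b))⁻¹).toMonoidHom.comp
    (MulAction.stabilizer G (T.edge i)).subtype).codRestrict _ fun c => by
      change _ • _ = _
      have : (MulAut.conj (T.mover (T.endpoint i b))⁻¹) (c : G)
        = (T.mover (T.endpoint i b))⁻¹ * c * T.mover (T.endpoint i b) := by simp
      change (MulAut.conj (T.mover (T.endpoint i b))⁻¹) (c : G) • _ = _
      rw [this, mul_smul, mul_smul, T.mover_smul, T.smul_endpoint c.2, inv_smul_eq_iff, T.mover_smul]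

theorem coe_endpointHom (i : ι) (b : Bool) (c : MulAction.stabilizer G (T.edge i)) :
    (T.endpointHom i b c : G) =
      (T.mover (T.endpoint i b))⁻¹ * c * T.mover (T.endpoint i b) := by
  change (MulAut.conj (T.mover (T.endpoint i b))⁻¹) (c : G) = _
  simp

theorem endpointHom_injective (i : ι) (b : Bool) : Function.Injective (T.endpointHom i b) := by
  intro c c' h
  have := congrArg Subtype.val h
  rw [coe_endpointHom, coe_endpointHom] at this
  exact Subtype.ext (by simpa using this)

/-- A relation that holds for the two ends of each edge in `S` holds for any two vertices that are
not separated by an edge outside `S`. -/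
theorem rel_vertex {R : Set P → Set P → Prop} (hR : Equivalence R) {S : Set P}
    (hS : ∀ e ∈ S, R (T.head (T.star e)) (T.head e)) (x y : T.Vertex)
    (h : ∀ e, e ∈ y.1 → e ∉ x.1 → e ∈ S) : R x.1 y.1 := by
  obtain ⟨x, hx⟩ := x
  obtain ⟨y, hy⟩ := y
  by_cases hP : IsEmpty P
  · obtain rfl : x = y := Subsingleton.elim x y
    exact hR.refl _
  · obtain ⟨p, rfl⟩ := hx.resolve_right hP
    obtain ⟨q, rfl⟩ := hy.resolve_right hP
    exact T.rel_head_head hR hS h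

/-- The quotient graph of groups. -/
noncomputable def graph : GraphOfGroups T.Orbit ι where
  src i := T.orbit (T.endpoint i true)
  tgt i := T.orbit (T.endpoint i false)
  vertexGroup v := MulAction.stabilizer G (T.rep v)
  edgeGroup i := MulAction.stabilizer G (T.edge i)
  srcHom i := T.endpointHom i true
  tgtHom i := T.endpointHom i false
  srcHom_injective i := T.endpointHom_injective i true
  tgtHom_injective i := T.endpointHom_injective i false
  connected := by
    let D : T.Orbit → T.Orbit → Prop := fun a b =>
      ∃ e : ι, T.orbit (T.endpoint e true) = a ∧ T.orbit (T.endpoint e false) = b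
    let R : Set P → Set P → Prop := fun s t => ∀ x : T.Vertex, x.1 = s →
      ∃ y : T.Vertex, y.1 = t ∧ Relation.EqvGen D (T.orbit x) (T.orbit y)
    let R' : Set P → Set P → Prop := fun s t => R s t ∧ R t s
    have hR : Equivalence R' := by
      refine ⟨fun s => ⟨fun x hx => ⟨x, hx, .refl _⟩, fun x hx => ⟨x, hx, .refl _⟩⟩,
        fun h => ⟨h.2, h.1⟩, ?_⟩
      have tr : ∀ {a b c}, R a b → R b c → R a c := fun h h' x hx => by
        obtain ⟨y, hy, hxy⟩ := h x hx
        obtain ⟨z, hz, hyz⟩ := h' y hy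
        exact ⟨z, hz, hxy.trans _ _ _ hyz⟩
      exact fun {_ _ _} h h' => ⟨tr h.1 h'.1, tr h'.2 h.2⟩
    have hedge : ∀ p, Relation.EqvGen D (T.orbit (T.headVertex (T.star p)))
        (T.orbit (T.headVertex p)) := by
      have pos : ∀ p, T.positive p = true →
          Relation.EqvGen D (T.orbit (T.headVertex (T.star p))) (T.orbit (T.headVertex p)) := by
        intro p hp
        obtain ⟨g, hg⟩ := T.exists_smul_edge p hp
        rw [hg, ← T.smul_star, headVertex_smul, headVertex_smul, orbit_smul, orbit_smul]
        exact .rel _ _ ⟨T.color p, rfl, rfl⟩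
      intro p
      cases hp : T.positive p
      · have := pos (T.star p) (by rw [T.positive_star, hp]; rfl)
        rw [T.star_star] at this
        exact this.symm _ _
      · exact pos p hp
    intro v w
    obtain ⟨h, -⟩ := T.rel_vertex hR (S := Set.univ) (fun e _ =>
      ⟨fun x hx => ⟨T.headVertex e, rfl, (Vertex.ext hx : x = T.headVertex _) ▸ hedge e⟩,
        fun x hx => ⟨T.headVertex (T.star e), rfl,
          (Vertex.ext hx : x = T.headVertex _) ▸ (hedge e).symm _ _⟩⟩)
      (T.rep v) (T.rep w) fun _ _ _ => Set.mem_univ _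
    obtain ⟨y, hy, hxy⟩ := h _ rfl
    rwa [Vertex.ext hy, orbit_rep, orbit_rep] at hxy

/-- The image in `G` of the letter of the path group given by the edge `i`. -/
noncomputable def letterValue (i : ι) : G :=
  (T.mover (T.endpoint i true))⁻¹ * T.mover (T.endpoint i false)

/-- The inclusion into `G` of the vertex groups of the quotient graph. -/
noncomputable def vertexHom (v : T.Orbit) : T.graph.vertexGroup v →* G :=
  (MulAction.stabilizer G (T.rep v)).subtype

/-- The inclusion into `G` of the edge groups of the quotient graph. -/
noncomputable def edgeHom (i : ι) : T.graph.edgeGroup i →* G :=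
  (MulAction.stabilizer G (T.edge i)).subtype

theorem vertexHom_injective (v : T.Orbit) : Function.Injective (T.vertexHom v) :=
  Subtype.val_injective

theorem vertexHom_smul (v : T.Orbit) (a : T.graph.vertexGroup v) :
    T.vertexHom v a • T.rep v = T.rep v := a.2

theorem exists_vertexHom {v : T.Orbit} {g : G} (hg : g • T.rep v = T.rep v) :
    ∃ a, T.vertexHom v a = g := ⟨(⟨g, hg⟩ : MulAction.stabilizer G (T.rep v)), rfl⟩

theorem edgeHom_smul (i : ι) (c : T.graph.edgeGroup i) : T.edgeHom i c • T.edge i = T.edge i := c.2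

theorem exists_edgeHom {i : ι} {g : G} (hg : g • T.edge i = T.edge i) :
    ∃ c, T.edgeHom i c = g := ⟨(⟨g, hg⟩ : MulAction.stabilizer G (T.edge i)), rfl⟩

theorem vertexHom_srcHom (i : ι) (c : T.graph.edgeGroup i) :
    T.vertexHom (T.graph.src i) (T.graph.srcHom i c) =
      (T.mover (T.endpoint i true))⁻¹ * T.edgeHom i c * T.mover (T.endpoint i true) :=
  T.coe_endpointHom i true c

theorem vertexHom_tgtHom (i : ι) (c : T.graph.edgeGroup i) :
    T.vertexHom (T.graph.tgt i) (T.graph.tgtHom i c) =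
      (T.mover (T.endpoint i false))⁻¹ * T.edgeHom i c * T.mover (T.endpoint i false) :=
  T.coe_endpointHom i false c

/-- The natural homomorphism to `G` before dividing by the edge relations. -/
noncomputable def preToGroup : T.graph.PrePathGroup →* G :=
  Monoid.Coprod.lift (Monoid.CoprodI.lift T.vertexHom) (FreeGroup.lift T.letterValue)

theorem normalClosure_relators_le : Subgroup.normalClosure T.graph.relators ≤ T.preToGroup.ker := by
  refine Subgroup.normalClosure_le_normal ?_
  rintro _ ⟨i, c, rfl⟩
  rw [SetLike.mem_coe, MonoidHom.mem_ker]
  simp only [preToGroup, map_mul, map_inv, Monoid.Coprod.lift_apply_inr, FreeGroup.lift_apply_of,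
    Monoid.Coprod.lift_apply_inl, Monoid.CoprodI.lift_of]
  rw [vertexHom_srcHom, vertexHom_tgtHom, letterValue]
  group

/-- The natural homomorphism of the path group to `G`. -/
noncomputable def toGroup : T.graph.PathGroup →* G :=
  QuotientGroup.lift _ T.preToGroup T.normalClosure_relators_le

@[simp] theorem toGroup_ofVertex (v : T.Orbit) (a : T.graph.vertexGroup v) :
    T.toGroup (T.graph.ofVertex v a) = T.vertexHom v a := by
  change T.preToGroup (Monoid.Coprod.inl (Monoid.CoprodI.of a)) = _
  simp [preToGroup]

@[simp] theorem toGroup_letter (i : ι) : T.toGroup (T.graph.letter i) = T.letterValue i := by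
  change T.preToGroup (Monoid.Coprod.inr (FreeGroup.of i)) = _
  simp [preToGroup]

theorem letter_mul_ofVertex (i : ι) (c : T.graph.edgeGroup i) :
    T.graph.letter i * T.graph.ofVertex _ (T.graph.tgtHom i c) * (T.graph.letter i)⁻¹ =
      T.graph.ofVertex _ (T.graph.srcHom i c) := by
  rw [← mul_inv_eq_one]
  exact (QuotientGroup.eq_one_iff _).2 (Subgroup.subset_normalClosure ⟨i, c, rfl⟩)

/-- `x` and `y` are vertices of the tree that are joined by a path through edges with colors
in `S`, written as a path of the quotient graph of groups. -/
def Joined (S : Set ι) (x y : Set P) : Prop :=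
  ∃ (v w : T.Orbit) (g h : G) (z : T.graph.PathGroup), (g • T.rep v).1 = x ∧ (h • T.rep w).1 = y ∧
    T.graph.IsPath S v w z ∧ g * T.toGroup z = h

theorem exists_isPath_of_smul_rep_eq (S : Set ι) {v w : T.Orbit} {g h : G}
    (heq : g • T.rep v = h • T.rep w) :
    ∃ z, T.graph.IsPath S v w z ∧ g * T.toGroup z = h := by
  obtain rfl : v = w := by
    rw [← T.orbit_rep v, ← T.orbit_smul g, heq, T.orbit_smul, T.orbit_rep]
  obtain ⟨a, ha⟩ := T.exists_vertexHom (v := v) (g := g⁻¹ * h) (by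
    rw [mul_smul, ← heq, inv_smul_smul])
  exact ⟨_, .vertex v a, by rw [toGroup_ofVertex, ha, mul_inv_cancel_left]⟩

theorem joined_equivalence (S : Set ι) : Equivalence fun x y => x = y ∨ T.Joined S x y where
  refl _ := Or.inl rfl
  symm := by
    rintro x y (rfl | ⟨v, w, g, h, z, hx, hy, hz, hgh⟩)
    · exact Or.inl rfl
    · exact Or.inr ⟨w, v, h, g, z⁻¹, hy, hx, hz.inv, by rw [← hgh, map_inv, mul_inv_cancel_right]⟩
  trans := by
    rintro x y t (rfl | ⟨v, w, g, h, z, hx, hy, hz, hgh⟩)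
    · exact id
    rintro (rfl | ⟨v', w', g', h', z', hx', hy', hz', hgh'⟩)
    · exact Or.inr ⟨v, w, g, h, z, hx, hy, hz, hgh⟩
    · obtain ⟨z'', hz'', h''⟩ := T.exists_isPath_of_smul_rep_eq S (Vertex.ext (hy.trans hx'.symm))
      exact Or.inr ⟨v, w', g, h', z * z'' * z', hx, hy', (hz.comp hz'').comp hz', by
        rw [map_mul, map_mul, ← hgh', ← h'', ← hgh]; simp only [mul_assoc]⟩

theorem joined_edge {S : Set ι} (p : P) (hp : T.color p ∈ S) :
    T.head (T.star p) = T.head p ∨ T.Joined S (T.head (T.star p)) (T.head p) := by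
  have pos : ∀ p, T.positive p = true → T.color p ∈ S →
      T.Joined S (T.head (T.star p)) (T.head p) := by
    intro p hp hc
    obtain ⟨g, hg⟩ := T.exists_smul_edge p hp
    refine ⟨_, _, g * T.mover (T.endpoint (T.color p) true),
      g * T.mover (T.endpoint (T.color p) false), _, ?_, ?_, .edge (T.color p) hc, ?_⟩
    · change ((_ * T.mover (T.endpoint (T.color p) true)) •
        T.rep (T.orbit (T.endpoint (T.color p) true))).1 = _
      rw [mul_smul, T.mover_smul, endpoint, ← headVertex_smul, T.smul_star, ← hg]
      rfl
    · change ((_ * T.mover (T.endpoint (T.color p) false)) •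
        T.rep (T.orbit (T.endpoint (T.color p) false))).1 = _
      rw [mul_smul, T.mover_smul, endpoint, ← headVertex_smul, ← hg]
      rfl
    · rw [toGroup_letter, letterValue]
      group
  cases h : T.positive p
  · have := pos (T.star p) (by rw [T.positive_star, h]; rfl) (by rwa [T.color_star])
    rw [T.star_star] at this
    exact (T.joined_equivalence S).symm (Or.inr this)
  · exact Or.inr (pos p h hp)

/-- Vertices of the tree that are only separated by edges with colors in `S` are joined by a path
through such edges. -/
theorem exists_isPath {S : Set ι} {v w : T.Orbit} {g h : G}
    (hsep : ∀ e, e ∈ (h • T.rep w).1 → e ∉ (g • T.rep v).1 → T.color e ∈ S) :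
    ∃ z, T.graph.IsPath S v w z ∧ g * T.toGroup z = h := by
  rcases T.rel_vertex (T.joined_equivalence S) (S := {e | T.color e ∈ S})
    (fun e he => T.joined_edge e he) (g • T.rep v) (h • T.rep w) hsep with
      heq | ⟨v', w', g', h', z, hx, hy, hz, hgh⟩
  · exact T.exists_isPath_of_smul_rep_eq S (Vertex.ext heq)
  · obtain ⟨z₁, hz₁, h₁⟩ := T.exists_isPath_of_smul_rep_eq S (Vertex.ext hx.symm)
    obtain ⟨z₂, hz₂, h₂⟩ := T.exists_isPath_of_smul_rep_eq S (Vertex.ext hy)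
    exact ⟨z₁ * z * z₂, (hz₁.comp hz).comp hz₂, by
      rw [map_mul, map_mul, ← h₂, ← hgh, ← h₁]; simp only [mul_assoc]⟩

/-- The initial (`true`) or terminal (`false`) vertex of the edge `i` of the quotient graph, which
is where its traversal in the positive (`true`) or negative direction starts. -/
noncomputable def origin (i : ι) : Bool → T.Orbit
  | true => T.graph.src i
  | false => T.graph.tgt i

/-- The letter of the path group for traversing the edge `i` in the given direction. -/
noncomputable def directedLetter (i : ι) : Bool → T.graph.PathGroup
  | true => T.graph.letter i
  | false => (T.graph.letter i)⁻¹

/-- The lift of the edge `i` with the given direction that starts at the representative of its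
initial vertex. -/
noncomputable def directedEdge (i : ι) : Bool → P
  | true => (T.mover (T.endpoint i true))⁻¹ • T.edge i
  | false => (T.mover (T.endpoint i false))⁻¹ • T.star (T.edge i)

theorem color_directedEdge (i : ι) (b : Bool) : T.color (T.directedEdge i b) = i := by
  cases b <;> simp [directedEdge, T.color_smul, T.color_star, T.color_edge]

theorem positive_directedEdge (i : ι) (b : Bool) : T.positive (T.directedEdge i b) = b := by
  cases b <;> simp [directedEdge, T.positive_smul, T.positive_star, T.positive_edge]

theorem headVertex_star_directedEdge (i : ι) (b : Bool) :
    T.headVertex (T.star (T.directedEdge i b)) = T.rep (T.origin i b) := by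
  cases b
  · rw [directedEdge, ← T.smul_star, T.star_star, headVertex_smul, inv_smul_eq_iff]
    exact (T.mover_smul _).symm
  · rw [directedEdge, ← T.smul_star, headVertex_smul, inv_smul_eq_iff]
    exact (T.mover_smul _).symm

theorem directedEdge_eq_smul_star (i : ι) (b : Bool) :
    T.directedEdge i b = T.toGroup (T.directedLetter i b) • T.star (T.directedEdge i !b) := by
  cases b
  · rw [directedLetter, map_inv, toGroup_letter, letterValue, Bool.not_false, directedEdge,
      directedEdge, ← T.smul_star, smul_smul]
    congr 1
    group
  · rw [directedLetter, toGroup_letter, letterValue, Bool.not_true, directedEdge,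
      directedEdge, ← T.smul_star, T.star_star, smul_smul]
    congr 1
    group

theorem headVertex_directedEdge (i : ι) (b : Bool) :
    T.headVertex (T.directedEdge i b) =
      T.toGroup (T.directedLetter i b) • T.rep (T.origin i !b) := by
  rw [directedEdge_eq_smul_star, headVertex_smul, headVertex_star_directedEdge]

/-- An element of a vertex group that fixes a lift of an adjacent edge can be moved across this
edge. -/
theorem exists_directedLetter_mul (i : ι) (b : Bool) (a : T.graph.vertexGroup (T.origin i !b))
    (ha : T.vertexHom _ a • T.directedEdge i (!b) = T.directedEdge i !b) :
    ∃ a', T.directedLetter i b * T.graph.ofVertex _ a * T.directedLetter i (!b) =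
      T.graph.ofVertex (T.origin i b) a' := by
  have conj : ∀ (x y : G) (p : P), x • y⁻¹ • p = y⁻¹ • p → (y * x * y⁻¹) • p = p := by
    intro x y p h
    rw [mul_smul, mul_smul, h, smul_inv_smul]
  cases b
  · obtain ⟨c, hc⟩ := T.exists_edgeHom (conj _ _ _ ha)
    obtain rfl : a = T.graph.srcHom i c := T.vertexHom_injective _ (by
      refine Eq.trans ?_ (T.vertexHom_srcHom i c).symm
      rw [hc]
      group)
    refine ⟨T.graph.tgtHom i c, ?_⟩
    change (T.graph.letter i)⁻¹ * T.graph.ofVertex (T.graph.src i) (T.graph.srcHom i c) *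
      T.graph.letter i = T.graph.ofVertex (T.graph.tgt i) (T.graph.tgtHom i c)
    rw [← letter_mul_ofVertex]
    group
  · have h' := conj _ _ _ ha
    rw [T.smul_star, T.star_inj] at h'
    obtain ⟨c, hc⟩ := T.exists_edgeHom h'
    obtain rfl : a = T.graph.tgtHom i c := T.vertexHom_injective _ (by
      refine Eq.trans ?_ (T.vertexHom_tgtHom i c).symm
      rw [hc]
      group)
    exact ⟨T.graph.srcHom i c, T.letter_mul_ofVertex i c⟩

/-- `IsReduced u v y l`: the element `y` of the path group is the class of a path without
backtracking from `u` to `v`, and `l` is the list of the edges, the last one first, through which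
its lift to the tree runs. -/
inductive IsReduced (u : T.Orbit) : T.Orbit → T.graph.PathGroup → List P → Prop
  | vertex (a : T.graph.vertexGroup u) : IsReduced u u (T.graph.ofVertex u a) []
  | snoc {y : T.graph.PathGroup} {l : List P} (i : ι) (b : Bool) (h : IsReduced u (T.origin i b) y l)
      (hl : ∀ p ∈ l.head?, p ≠ T.star (T.toGroup y • T.directedEdge i b))
      (a : T.graph.vertexGroup (T.origin i !b)) :
      IsReduced u (T.origin i !b) (y * T.directedLetter i b * T.graph.ofVertex _ a)
        (T.toGroup y • T.directedEdge i b :: l)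

variable {T}

theorem IsReduced.mul_vertex {u v : T.Orbit} {y : T.graph.PathGroup} {l : List P}
    (h : T.IsReduced u v y l) (a : T.graph.vertexGroup v) :
    T.IsReduced u v (y * T.graph.ofVertex v a) l := by
  cases h with
  | vertex a' => rw [← map_mul]; exact .vertex _
  | snoc i b h hl a' => rw [mul_assoc, ← map_mul]; exact h.snoc i b hl _

theorem IsReduced.mul_directedLetter {u v : T.Orbit} {y : T.graph.PathGroup} {l : List P}
    (h : T.IsReduced u v y l) (i : ι) (b : Bool) (hv : v = T.origin i b) :
    ∃ l', T.IsReduced u (T.origin i !b) (y * T.directedLetter i b) l' := by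
  by_cases hl : ∀ p ∈ l.head?, p ≠ T.star (T.toGroup y • T.directedEdge i b)
  · subst hv
    have := h.snoc i b hl 1
    rw [map_one, mul_one] at this
    exact ⟨_, this⟩
  · cases h with
    | vertex a => simp at hl
    | @snoc y l j b' h hl' a =>
      simp only [List.head?_cons, Option.mem_some_iff, forall_eq', not_not] at hl
      have hj := congrArg T.color hl
      rw [T.color_star, T.color_smul, T.color_smul, color_directedEdge, color_directedEdge] at hj
      subst hj
      have hb := congrArg T.positive hl
      rw [T.positive_star, T.positive_smul, T.positive_smul, positive_directedEdge,
        positive_directedEdge] at hb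
      obtain rfl : b = !b' := by rw [hb, Bool.not_not]
      rw [map_mul, map_mul, toGroup_ofVertex, mul_assoc, mul_smul, ← T.smul_star, smul_left_cancel_iff,
        directedEdge_eq_smul_star, mul_smul, ← T.smul_star, ← T.smul_star, smul_left_cancel_iff,
        T.smul_star, T.star_inj] at hl
      obtain ⟨a', ha'⟩ := T.exists_directedLetter_mul j b' a hl.symm
      refine ⟨l, ?_⟩
      rw [mul_assoc y, mul_assoc y, ha']
      have := h.mul_vertex a'
      cases b' <;> exact this

theorem IsReduced.mul_isPath {S : Set ι} {v w : T.Orbit} {x : T.graph.PathGroup}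
    (hx : T.graph.IsPath S v w x) : ∀ {u y l}, T.IsReduced u v y l →
      ∃ l', T.IsReduced u w (y * x) l' := by
  induction hx with
  | vertex v a => exact fun h => ⟨_, h.mul_vertex a⟩
  | edge i hi => exact fun h => h.mul_directedLetter i true rfl
  | edge_inv i hi => exact fun h => h.mul_directedLetter i false rfl
  | comp _ _ ih₁ ih₂ =>
    intro u y l h
    obtain ⟨l₁, h₁⟩ := ih₁ h
    obtain ⟨l₂, h₂⟩ := ih₂ h₁
    rw [mul_assoc] at h₂
    exact ⟨l₂, h₂⟩

/-- The edges through which a path without backtracking runs are increasing. -/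
theorem IsReduced.increasing {u v : T.Orbit} {y : T.graph.PathGroup} {l : List P}
    (h : T.IsReduced u v y l) : (l = [] ∧ T.toGroup y • T.rep v = T.rep u) ∨ ∃ p q, l.head? = some q ∧ p ≤ q ∧
      T.headVertex (T.star p) = T.rep u ∧ T.headVertex q = T.toGroup y • T.rep v := by
  induction h with
  | vertex a => exact Or.inl ⟨rfl, by rw [toGroup_ofVertex]; exact T.vertexHom_smul _ _⟩
  | @snoc y l i b h hl a ih =>
    right
    have htail : T.headVertex (T.star (T.toGroup y • T.directedEdge i b)) =
        T.toGroup y • T.rep (T.origin i b) := by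
      rw [← T.smul_star, headVertex_smul, headVertex_star_directedEdge]
    have hhead : T.headVertex (T.toGroup y • T.directedEdge i b) =
        T.toGroup (y * T.directedLetter i b * T.graph.ofVertex _ a) • T.rep (T.origin i !b) := by
      rw [headVertex_smul, headVertex_directedEdge, map_mul, map_mul, toGroup_ofVertex, mul_smul,
        mul_smul, vertexHom_smul]
    rcases ih with ⟨-, hy⟩ | ⟨p, q, hq, hpq, hp, hqy⟩
    · exact ⟨_, _, rfl, le_rfl, htail.trans hy, hhead⟩
    · refine ⟨p, _, rfl, ?_, hp, hhead⟩
      have heq : T.head q = T.head (T.star (T.toGroup y • T.directedEdge i b)) :=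
        congrArg Subtype.val (hqy.trans htail.symm)
      have := T.eq_or_lt_star (heq ▸ T.self_mem_head)
        (heq.symm ▸ T.self_mem_head)
      rw [T.star_star] at this
      exact hpq.trans (this.resolve_left (hl q hq)).le

variable (T)

theorem toGroup_injOn {v : T.Orbit} {x : T.graph.PathGroup} (hx : T.graph.IsPath Set.univ v v x)
    (h : T.toGroup x = 1) : x = 1 := by
  obtain ⟨l, hl⟩ := IsReduced.mul_isPath hx (.vertex 1)
  rw [map_one, one_mul] at hl
  rcases hl.increasing with ⟨rfl, -⟩ | ⟨p, q, -, hpq, hp, hq⟩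
  · cases hl with
    | vertex a =>
      rw [toGroup_ofVertex] at h
      rw [T.vertexHom_injective v (h.trans (map_one _).symm), map_one]
  · -- a closed path without backtracking would end with the edge `q` at the tail of `p`
    rw [h, one_smul, ← hp] at hq
    have heq : T.head q = T.head (T.star p) := congrArg Subtype.val hq
    have := T.eq_or_lt_star (heq ▸ T.self_mem_head) (heq.symm ▸ T.self_mem_head)
    rw [T.star_star] at this
    rcases this with rfl | h'
    · exact absurd hpq T.not_le_star_self
    · exact absurd hpq h'.not_ge

/-- The fundamental group of the quotient graph of groups is `G`. -/
noncomputable def fundamentalGroupEquiv (v : T.Orbit) : T.graph.FundamentalGroup v ≃* G :=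
  MulEquiv.ofBijective (T.toGroup.comp (T.graph.loops Set.univ v).subtype) <| by
    refine ⟨(injective_iff_map_eq_one _).2 fun x hx => Subtype.ext (T.toGroup_injOn x.2 hx),
      fun g => ?_⟩
    obtain ⟨z, hz, h⟩ := T.exists_isPath (S := Set.univ) (v := v) (w := v) (g := 1) (h := g)
      fun _ _ _ => Set.mem_univ _
    exact ⟨⟨z, hz⟩, by rw [← h, one_mul]; rfl⟩

theorem mem_transport {v w : T.Orbit} {p : T.graph.PathGroup} {L : Subgroup T.graph.PathGroup}
    (hp : T.graph.IsPath Set.univ v w p) (hL : L ≤ T.graph.loops Set.univ w) {g : G} :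
    g ∈ T.graph.transport (T.fundamentalGroupEquiv v) p L ↔
      ∃ x ∈ L, g = T.toGroup p * T.toGroup x * (T.toGroup p)⁻¹ := by
  constructor
  · rintro ⟨⟨_, hx'⟩, ⟨x, hx, rfl⟩, rfl⟩
    exact ⟨x, hx, by
      change T.toGroup (p * x * p⁻¹) = _
      rw [map_mul, map_mul, map_inv]⟩
  · rintro ⟨x, hx, rfl⟩
    refine ⟨⟨p * x * p⁻¹, (hp.comp (hL hx)).comp hp.inv⟩, ⟨x, hx, rfl⟩, ?_⟩
    change T.toGroup (p * x * p⁻¹) = _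
    rw [map_mul, map_mul, map_inv]

end TreeOrder
end AlmostInvariant

/-! ### Collapsing to one orbit of edges: amalgamated free products -/

namespace AlmostInvariant
namespace TreeOrder

section PingPong

variable {G ι P : Type*} [Group G] [PartialOrder P] [MulAction G P] (T : TreeOrder G ι P) (i : ι)
  {p q : P} {g x : G}

/-- The chosen edge of color `i` directed towards its tail (`true`) or towards its head
(`false`). -/
def towards : Bool → P
  | true => T.star (T.edge i)
  | false => T.edge i

/-- The tail (`true`) and the head (`false`) of the chosen edge of color `i` in the tree obtained
by collapsing all edges of other colors. -/
def collapsedEnd (b : Bool) : Set P := T.restrict i (T.head (T.towards i b))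

/-- The elements that carry the chosen edge of color `i` beyond the edge `p`. -/
def beyond (p : P) : Set G := {g | p < g • T.edge i ∨ p < g • T.star (T.edge i)}

theorem star_towards (b : Bool) : T.star (T.towards i b) = T.towards i !b := by
  cases b
  · rfl
  · exact T.star_star _

theorem color_towards (b : Bool) : T.color (T.towards i b) = i := by
  cases b <;> simp [towards, T.color_star, T.color_edge]

theorem smul_towards_eq (b : Bool) :
    x • T.towards i b = T.towards i b ↔ x ∈ MulAction.stabilizer G (T.edge i) := by
  cases b
  · exact Iff.rfl
  · rw [towards, T.smul_star, T.star_inj]; rfl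

variable {i}

theorem mul_mem_beyond (hp : p ≤ x • q) (hg : g ∈ T.beyond i q) : x * g ∈ T.beyond i p := by
  rw [beyond, Set.mem_ofPred_eq, mul_smul, mul_smul]
  exact hg.imp (fun h => hp.trans_lt ((T.smul_lt_smul_iff x).2 h))
    fun h => hp.trans_lt ((T.smul_lt_smul_iff x).2 h)

theorem mul_stabilizer_mem_beyond {b : Bool} (hp : p < x • T.towards i b)
    (hg : g ∈ MulAction.stabilizer G (T.edge i)) : x * g ∈ T.beyond i p := by
  rw [← T.smul_towards_eq i b] at hg
  rw [← hg, ← mul_smul] at hp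
  cases b
  · exact Or.inl hp
  · exact Or.inr hp

variable (i)

/-- Every element fixes the chosen edge or carries it beyond one of its ends. -/
theorem mem_beyond_or (g : G) : g ∈ MulAction.stabilizer G (T.edge i) ∨
    g ∈ T.beyond i (T.edge i) ∨ g ∈ T.beyond i (T.star (T.edge i)) := by
  have hne : T.edge i ≠ g • T.star (T.edge i) := fun h => T.smul_ne_star g (by
    rw [T.smul_star] at h
    rw [← T.star_star (g • T.edge i), ← h])
  rcases T.nested (T.edge i) (g • T.edge i) with h | h | h | h
  · rcases h.eq_or_lt with h | h
    · exact Or.inl h.symm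
    · exact Or.inr (Or.inl (Or.inl h))
  · rw [← T.smul_star] at h
    exact Or.inr (Or.inl (Or.inr (h.lt_of_ne hne)))
  · exact Or.inr (Or.inr (Or.inl (h.lt_of_ne (T.star_ne_smul g))))
  · rcases h.eq_or_lt with h | h
    · exact Or.inl h
    · refine Or.inr (Or.inr (Or.inr ?_))
      rw [T.smul_star]
      exact T.star_lt_star h

variable {i}

theorem notMem_beyond_star (h : g ∈ T.beyond i p) : g ∉ T.beyond i (T.star p) := by
  have key : ∀ q, p < q → ¬ T.star p < T.star q := fun q h1 h2 =>
    (h1.trans_le (by simpa [T.star_star] using (T.star_lt_star h2).le)).false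
  rintro (h' | h')
  · rcases h with h | h
    · exact T.not_star_le h.le h'.le
    · rw [T.smul_star] at h
      exact key _ h (by rwa [T.star_star])
  · rcases h with h | h
    · rw [T.smul_star] at h'
      exact key _ h h'
    · exact T.not_star_le h.le h'.le

theorem notMem_beyond_of_mem_stabilizer (hg : g ∈ MulAction.stabilizer G (T.edge i)) (b : Bool) :
    g ∉ T.beyond i (T.towards i b) := by
  have h1 : g • T.edge i = T.edge i := hg
  rintro (h | h)
  · cases b
    · rw [h1] at h; exact h.false
    · rw [h1] at h; exact T.not_star_le_self h.le
  · rw [T.smul_star, h1] at h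
    cases b
    · exact T.not_le_star_self h.le
    · exact h.false

/-- An element carrying one end of the collapsed edge to one of its ends fixes the edge or carries
it beyond this end. -/
theorem towards_lt_of_smul_collapsedEnd {b c : Bool}
    (hx : x • T.collapsedEnd i b = T.collapsedEnd i c) :
    (b = c ∧ x ∈ MulAction.stabilizer G (T.edge i)) ∨ T.towards i c < x • T.towards i !b := by
  rw [collapsedEnd, collapsedEnd, ← T.restrict_smul, ← T.head_smul] at hx
  rcases T.eq_or_lt_star_of_restrict_eq (T.color_towards i c)
    (by rw [T.color_smul, T.color_towards]) hx.symm with h | h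
  · left
    have hb : b = c := by
      by_contra hbc
      obtain rfl : c = !b := by cases b <;> cases c <;> simp_all
      rw [← T.star_towards] at h
      exact T.star_ne_smul x h
    subst hb
    exact ⟨rfl, (T.smul_towards_eq i b).1 h.symm⟩
  · right
    rwa [← T.smul_star, T.star_towards] at h

theorem stabilizer_edge_le (b : Bool) :
    MulAction.stabilizer G (T.edge i) ≤ MulAction.stabilizer G (T.collapsedEnd i b) := by
  intro g hg
  rw [MulAction.mem_stabilizer_iff, collapsedEnd, ← T.restrict_smul, ← T.head_smul,
    (T.smul_towards_eq i b).2 hg]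

/-- The collapsed tree is connected: a subgroup is the whole group if it contains the stabilizers of
the ends of the collapsed edge and all elements carrying its tail to its head. -/
theorem eq_top_of_stabilizer_le (K : Subgroup G)
    (hK : ∀ b, MulAction.stabilizer G (T.collapsedEnd i b) ≤ K)
    (hK' : ∀ x : G, x • T.collapsedEnd i true = T.collapsedEnd i false → x ∈ K) : K = ⊤ := by
  let Q : Set P → Prop := fun s => ∃ k ∈ K, ∃ b, T.restrict i s = k • T.collapsedEnd i b
  have hend : ∀ (g : G) (b : Bool),
      T.restrict i (T.head (g • T.towards i b)) = g • T.collapsedEnd i b := fun g b => by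
    rw [T.head_smul, T.restrict_smul]; rfl
  have hQ : ∀ (g : G) (b : Bool), Q (T.head (g • T.towards i b)) → g ∈ K := by
    rintro g b ⟨k, hk, c, h⟩
    rw [hend, ← inv_smul_eq_iff, smul_smul] at h
    suffices k⁻¹ * g ∈ K by simpa using K.mul_mem hk this
    cases b <;> cases c
    · exact hK _ h
    · have := hK' (k⁻¹ * g)⁻¹ (by rw [← h, inv_smul_smul])
      exact K.inv_mem_iff.1 this
    · exact hK' _ h
    · exact hK _ h
  have hQ' : ∀ (g : G) (b : Bool), g ∈ K → Q (T.head (g • T.towards i b)) :=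
    fun g b hg => ⟨g, hg, b, hend g b⟩
  have hR : Equivalence fun s t => (Q s ↔ Q t) :=
    ⟨fun _ => Iff.rfl, fun h => h.symm, fun h h' => h.trans h'⟩
  have pos : ∀ p, T.positive p = true → (Q (T.head (T.star p)) ↔ Q (T.head p)) := by
    intro p hp
    by_cases hc : T.color p = i
    · obtain ⟨g, hg⟩ := T.exists_smul_edge p hp
      rw [hc] at hg
      rw [hg, ← T.smul_star]
      exact ⟨fun h => hQ' g false (hQ g true h), fun h => hQ' g true (hQ g false h)⟩
    · simp only [Q, T.restrict_head_star hc]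
  have hedge : ∀ p, (Q (T.head (T.star p)) ↔ Q (T.head p)) := by
    intro p
    cases hp : T.positive p
    · have := pos (T.star p) (by rw [T.positive_star, hp]; rfl)
      rw [T.star_star] at this
      exact this.symm
    · exact pos p hp
  refine (Subgroup.eq_top_iff' K).2 fun g => hQ g false ?_
  refine (T.rel_head_head hR (S := Set.univ) (fun e _ => hedge e) (p := T.edge i)
    fun _ _ _ => Set.mem_univ _).1 ?_
  have := hQ' 1 false K.one_mem
  rwa [one_smul] at this

end PingPong

section Amalgam

variable {G ι P : Type*} [Group G] [PartialOrder P] [MulAction G P] (T : TreeOrder G ι P) (i : ι)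

/-- The natural maps of the stabilizer of the chosen edge to the stabilizers of its collapsed
ends. -/
abbrev factorHom (b : Bool) : MulAction.stabilizer G (T.edge i) →*
    MulAction.stabilizer G (T.collapsedEnd i b) := Subgroup.inclusion (T.stabilizer_edge_le b)

/-- The natural map of the amalgamated free product of the stabilizers of the ends of the collapsed
edge to `G`. -/
abbrev amalgamHom : Monoid.PushoutI (T.factorHom i) →* G :=
  Monoid.PushoutI.lift (φ := fun b => Subgroup.inclusion (T.stabilizer_edge_le (i := i) b))
    (fun b => (MulAction.stabilizer G (T.collapsedEnd i b)).subtype)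
    (MulAction.stabilizer G (T.edge i)).subtype (fun _ => rfl)

variable {i}

theorem amalgamHom_base (c : MulAction.stabilizer G (T.edge i)) :
    T.amalgamHom i (Monoid.PushoutI.base _ c) = c :=
  Monoid.PushoutI.lift_base (φ := T.factorHom i) _ _ _ c

theorem amalgamHom_of (b : Bool) (x : MulAction.stabilizer G (T.collapsedEnd i b)) :
    T.amalgamHom i (Monoid.PushoutI.of b x) = x :=
  Monoid.PushoutI.lift_of (φ := T.factorHom i) _ _ _ x

theorem mem_range_factorHom {b : Bool} (x : MulAction.stabilizer G (T.collapsedEnd i b)) :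
    x ∈ (T.factorHom i b).range ↔ (x : G) ∈ MulAction.stabilizer G (T.edge i) :=
  ⟨by rintro ⟨c, rfl⟩; exact c.2, fun h => ⟨⟨x, h⟩, rfl⟩⟩

/-- Ping-pong: a reduced word carries the edge beyond the end fixed by its first letter. -/
theorem list_prod_mem_beyond (l : List (Σ b, MulAction.stabilizer G (T.collapsedEnd i b)))
    (hl : l.IsChain fun x y => x.1 ≠ y.1)
    (hr : ∀ x ∈ l, (x.2 : G) ∉ MulAction.stabilizer G (T.edge i)) (b : Bool)
    (hb : l.head?.map Sigma.fst = some b) :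
    (l.map fun x => (x.2 : G)).prod ∈ T.beyond i (T.towards i b) := by
  induction l generalizing b with
  | nil => simp at hb
  | cons x l ih =>
    obtain rfl : x.1 = b := by simpa using hb
    have hx := (T.towards_lt_of_smul_collapsedEnd x.2.2).resolve_left
      fun h => hr x List.mem_cons_self h.2
    rw [List.map_cons, List.prod_cons]
    cases l with
    | nil =>
      exact T.mul_stabilizer_mem_beyond hx (Subgroup.one_mem _)
    | cons y l =>
      obtain ⟨hxy, hl⟩ := List.isChain_cons_cons.1 hl
      have := ih hl (fun z hz => hr z (List.mem_cons_of_mem _ hz)) y.1 rfl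
      rw [show y.1 = !x.1 by cases h : x.1 <;> cases h' : y.1 <;> simp_all] at this
      exact T.mul_mem_beyond hx.le this

theorem lift_word_prod (w : Monoid.CoprodI.Word
    fun b => MulAction.stabilizer G (T.collapsedEnd i b)) :
    Monoid.CoprodI.lift (fun b => (MulAction.stabilizer G (T.collapsedEnd i b)).subtype) w.prod =
      (w.toList.map fun x => (x.2 : G)).prod := by
  rw [Monoid.CoprodI.Word.prod, map_list_prod, List.map_map]
  congr 1

/-- The elements represented by a reduced word that starts with a letter of the factor `b`. -/
def reducedSet (i : ι) (b : Bool) : Set G :=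
  {g | ∃ w : Monoid.CoprodI.Word (fun b => MulAction.stabilizer G (T.collapsedEnd i b)),
      Monoid.PushoutI.Reduced (T.factorHom i) w ∧ w.fstIdx = some b ∧
      Monoid.CoprodI.lift (fun b => (MulAction.stabilizer G (T.collapsedEnd i b)).subtype)
        w.prod = g}

theorem reducedSet_subset (b : Bool) : T.reducedSet i b ⊆ T.beyond i (T.towards i b) := by
  rintro _ ⟨w, hw, hb, rfl⟩
  rw [lift_word_prod]
  exact T.list_prod_mem_beyond _ w.chain_ne
    (fun x hx h => hw x hx ((T.mem_range_factorHom _).2 h)) b hb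

theorem mul_mem_reducedSet {b : Bool} {c g : G} (hc : c ∈ MulAction.stabilizer G (T.edge i))
    (hg : g ∈ T.reducedSet i b) : c * g ∈ T.reducedSet i b := by
  obtain ⟨⟨l, h1, hch⟩, hw, hb, rfl⟩ := hg
  rcases l with - | ⟨⟨b', y⟩, l⟩
  · simp [Monoid.CoprodI.Word.fstIdx] at hb
  · obtain rfl : b' = b := by simpa [Monoid.CoprodI.Word.fstIdx] using hb
    have hcy : T.factorHom i b' ⟨c, hc⟩ * y ∉ (T.factorHom i b').range := fun h =>
      hw ⟨b', y⟩ List.mem_cons_self (by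
        have := Subgroup.mul_mem _ (Subgroup.inv_mem _ (⟨⟨c, hc⟩, rfl⟩ :
          T.factorHom i b' ⟨c, hc⟩ ∈ (T.factorHom i b').range)) h
        rwa [inv_mul_cancel_left] at this)
    refine ⟨⟨⟨b', T.factorHom i b' ⟨c, hc⟩ * y⟩ :: l, ?_, ?_⟩, ?_, rfl, ?_⟩
    · intro z hz
      rcases List.mem_cons.1 hz with rfl | hz
      · exact fun h => hcy (by
          have h' : T.factorHom i b' ⟨c, hc⟩ * y = 1 := h
          rw [h']
          exact Subgroup.one_mem _)
      · exact h1 z (List.mem_cons_of_mem _ hz)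
    · rw [List.isChain_cons] at hch ⊢
      exact hch
    · intro z hz
      rcases List.mem_cons.1 hz with rfl | hz
      · exact hcy
      · exact hw z (List.mem_cons_of_mem _ hz)
    · rw [lift_word_prod, lift_word_prod]
      simp [mul_assoc]

/-- An element of the amalgamated free product is either in the amalgamated subgroup or represented
by a reduced word. -/
theorem amalgam_normal_form (x : Monoid.PushoutI (T.factorHom i)) :
    (∃ c, x = Monoid.PushoutI.base _ c) ∨ ∃ b, T.amalgamHom i x ∈ T.reducedSet i b := by
  obtain ⟨d⟩ := Monoid.PushoutI.NormalWord.transversal_nonempty (T.factorHom i)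
    fun b => Subgroup.inclusion_injective _
  classical
  obtain ⟨w, rfl⟩ := (Monoid.PushoutI.NormalWord.equiv (d := d)).symm.surjective x
  change (∃ c, w.prod = _) ∨ ∃ b, T.amalgamHom i w.prod ∈ _
  have hw : Monoid.PushoutI.Reduced (T.factorHom i) w.toWord := by
    rintro ⟨b, y⟩ hy ⟨c, hc⟩
    have h1 := w.normalized b y hy
    have h2 := (d.compl b).1 (a₁ := (⟨y, ⟨c, hc⟩⟩, ⟨1, d.one_mem b⟩)) (a₂ := (1, ⟨y, h1⟩))
      (by simp)
    exact w.ne_one _ hy (by simpa using (congrArg (fun z => (z.2 : _)) h2).symm)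
  have hprod : T.amalgamHom i w.prod = w.head *
      Monoid.CoprodI.lift (fun b => (MulAction.stabilizer G (T.collapsedEnd i b)).subtype)
        w.toWord.prod := by
    rw [Monoid.PushoutI.NormalWord.prod, map_mul, amalgamHom_base]
    congr 1
    have : (T.amalgamHom i).comp Monoid.PushoutI.ofCoprodI =
        Monoid.CoprodI.lift (fun b => (MulAction.stabilizer G (T.collapsedEnd i b)).subtype) := by
      ext b y
      simp [amalgamHom_of]
    exact DFunLike.congr_fun this _
  rcases h : w.toList with - | ⟨⟨b, y⟩, l⟩
  · left
    refine ⟨w.head, ?_⟩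
    rw [Monoid.PushoutI.NormalWord.prod, Monoid.CoprodI.Word.prod, h]
    simp
  · right
    refine ⟨b, ?_⟩
    rw [hprod]
    refine T.mul_mem_reducedSet w.head.2 ⟨w.toWord, hw, ?_, rfl⟩
    rw [Monoid.CoprodI.Word.fstIdx, h]
    rfl

theorem amalgamHom_injective : Function.Injective (T.amalgamHom i) := by
  refine (injective_iff_map_eq_one _).2 fun x hx => ?_
  rcases T.amalgam_normal_form x with ⟨c, rfl⟩ | ⟨b, hb⟩
  · rw [amalgamHom_base] at hx
    rw [show c = 1 from Subtype.ext hx, map_one]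
  · rw [hx] at hb
    exact absurd (T.reducedSet_subset b hb)
      (T.notMem_beyond_of_mem_stabilizer (Subgroup.one_mem _) b)

theorem amalgamHom_surjective
    (hi : ¬ ∃ x : G, x • T.collapsedEnd i true = T.collapsedEnd i false) :
    Function.Surjective (T.amalgamHom i) := by
  rw [← MonoidHom.range_eq_top]
  refine T.eq_top_of_stabilizer_le (i := i) _ (fun b x hx => ?_) fun x hx => absurd ⟨x, hx⟩ hi
  exact ⟨Monoid.PushoutI.of b ⟨x, hx⟩, T.amalgamHom_of b _⟩

theorem reducedSet_eq (hi : ¬ ∃ x : G, x • T.collapsedEnd i true = T.collapsedEnd i false)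
    (b : Bool) : T.reducedSet i b = T.beyond i (T.towards i b) := by
  refine (T.reducedSet_subset b).antisymm fun g hg => ?_
  obtain ⟨x, rfl⟩ := T.amalgamHom_surjective hi g
  rcases T.amalgam_normal_form x with ⟨c, rfl⟩ | ⟨c, hc⟩
  · rw [amalgamHom_base] at hg
    exact absurd hg (T.notMem_beyond_of_mem_stabilizer c.2 b)
  · by_cases hbc : c = b
    · exact hbc ▸ hc
    · obtain rfl : c = !b := by cases b <;> cases c <;> simp_all
      have := T.reducedSet_subset _ hc
      rw [← T.star_towards] at this
      exact absurd this (T.notMem_beyond_star hg)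

variable (i) in
/-- The splitting of `G` obtained from the collapsed tree if the ends of its edges are not in the
same orbit. -/
def amalgamSplitting (hi : ¬ ∃ x : G, x • T.collapsedEnd i true = T.collapsedEnd i false)
    (hproper : ∀ b, MulAction.stabilizer G (T.collapsedEnd i b) ≠ ⊤) : AmalgamSplitting G where
  factor b := MulAction.stabilizer G (T.collapsedEnd i b)
  edge := MulAction.stabilizer G (T.edge i)
  edge_le b := T.stabilizer_edge_le b
  proper := hproper
  bijective := ⟨T.amalgamHom_injective, T.amalgamHom_surjective hi⟩

end Amalgam

end TreeOrder
end AlmostInvariant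

/-! ### Collapsing to one orbit of edges: HNN extensions -/

namespace AlmostInvariant
namespace TreeOrder

section HNN

variable {G ι P : Type*} [Group G] [PartialOrder P] [MulAction G P] (T : TreeOrder G ι P) (i : ι)

/-- The stabilizer of the collapsed tail of the chosen edge. -/
abbrev tailStabilizer : Subgroup G := MulAction.stabilizer G (T.collapsedEnd i true)

/-- The stabilizer of the chosen edge, in the stabilizer of its tail. -/
abbrev edgeSubgroup : Subgroup (T.tailStabilizer i) :=
  (MulAction.stabilizer G (T.edge i)).subgroupOf (T.tailStabilizer i)

/-- The elements of the stabilizer of the tail that `t` conjugates into the stabilizer of the chosen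
edge. -/
abbrev conjEdgeSubgroup (t : G) : Subgroup (T.tailStabilizer i) :=
  ((MulAction.stabilizer G (T.edge i)).comap (MulAut.conj t).toMonoidHom).subgroupOf
    (T.tailStabilizer i)

variable {i} {t : G}

theorem mem_edgeSubgroup {a : T.tailStabilizer i} :
    a ∈ T.edgeSubgroup i ↔ (a : G) ∈ MulAction.stabilizer G (T.edge i) := Iff.rfl

theorem mem_conjEdgeSubgroup {a : T.tailStabilizer i} :
    a ∈ T.conjEdgeSubgroup i t ↔ t * a * t⁻¹ ∈ MulAction.stabilizer G (T.edge i) := Iff.rfl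

/-- Conjugation by an element `t` that carries the tail of the chosen edge to its head. -/
def conjEquiv (ht : t • T.collapsedEnd i true = T.collapsedEnd i false) :
    T.conjEdgeSubgroup i t ≃* T.edgeSubgroup i where
  toFun a := ⟨⟨t * a * t⁻¹, T.stabilizer_edge_le true (T.mem_conjEdgeSubgroup.1 a.2)⟩,
    T.mem_conjEdgeSubgroup.1 a.2⟩
  invFun c := ⟨⟨t⁻¹ * (c : T.tailStabilizer i) * t, by
      have hc := T.stabilizer_edge_le (i := i) false (T.mem_edgeSubgroup.1 c.2)
      rw [MulAction.mem_stabilizer_iff] at hc ⊢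
      rw [mul_smul, mul_smul, ht, hc, ← ht, inv_smul_smul]⟩, by
    rw [mem_conjEdgeSubgroup]
    have := T.mem_edgeSubgroup.1 c.2
    simpa [mul_assoc] using this⟩
  left_inv a := Subtype.ext (Subtype.ext (by simp [mul_assoc]))
  right_inv c := Subtype.ext (Subtype.ext (by simp [mul_assoc]))
  map_mul' a b := Subtype.ext (Subtype.ext (by simp [mul_assoc]))

variable (ht : t • T.collapsedEnd i true = T.collapsedEnd i false)

theorem conjEquiv_comm (c : T.conjEdgeSubgroup i t) :
    t * (T.tailStabilizer i).subtype c =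
      (T.tailStabilizer i).subtype (T.conjEquiv ht c) * t := by
  change t * (c : T.tailStabilizer i) = t * (c : T.tailStabilizer i) * t⁻¹ * t
  rw [inv_mul_cancel_right]

/-- The natural map of the HNN extension of the stabilizer of the tail to `G`. -/
abbrev hnnHom : HNNExtension (T.tailStabilizer i) (T.conjEdgeSubgroup i t) (T.edgeSubgroup i)
    (T.conjEquiv ht) →* G :=
  HNNExtension.lift (T.tailStabilizer i).subtype t (T.conjEquiv_comm ht)

/-- An element carrying the tail of the chosen edge to itself fixes it or carries it away. -/
theorem mem_stabilizer_or_mem_beyond {a : G} (ha : a ∈ T.tailStabilizer i) :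
    a ∈ MulAction.stabilizer G (T.edge i) ∨ T.star (T.edge i) < a • T.edge i :=
  (T.towards_lt_of_smul_collapsedEnd (i := i) (b := true) (c := true) ha).imp And.right id

/-- An edge that starts at the collapsed head of the chosen edge follows it. -/
theorem lt_smul_of_smul_tail {x : G} (hx : x • T.collapsedEnd i true = T.collapsedEnd i false) :
    T.edge i < x • T.edge i :=
  (T.towards_lt_of_smul_collapsedEnd hx).resolve_left fun h => Bool.noConfusion h.1

/-- The reverse of an edge that ends at the collapsed tail of the chosen edge follows the reverse
of the chosen edge. -/
theorem lt_smul_of_smul_head {x : G} (hx : x • T.collapsedEnd i false = T.collapsedEnd i true) :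
    T.star (T.edge i) < x • T.star (T.edge i) :=
  (T.towards_lt_of_smul_collapsedEnd hx).resolve_left fun h => Bool.noConfusion h.1

/-- Moving by an element that carries the head of the chosen edge to its tail. -/
theorem mul_mem_beyond_of_smul_head {x w : G}
    (hx : x • T.collapsedEnd i false = T.collapsedEnd i true)
    (hw : w ∈ MulAction.stabilizer G (T.edge i) ∨ w ∈ T.beyond i (T.star (T.edge i))) :
    x * w ∈ T.beyond i (T.star (T.edge i)) := by
  have h := T.lt_smul_of_smul_head hx
  rcases hw with hw | hw
  · exact T.mul_stabilizer_mem_beyond (b := true) h hw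
  · exact T.mul_mem_beyond h.le hw

/-- The product in `G` of the part of a reduced word after its head. -/
def wordValue (t : G) (l : List (ℤˣ × T.tailStabilizer i)) : G :=
  (l.map fun x => t ^ (x.1 : ℤ) * (x.2 : G)).prod

/-- Ping-pong: a reduced word that starts with `t` carries the edge beyond its head, and one that
starts with `t⁻¹` is of the form `t⁻¹ w`, where `w` fixes the edge or carries it beyond its tail. -/
theorem wordValue_spec (ht : t • T.collapsedEnd i true = T.collapsedEnd i false)
    (l : List (ℤˣ × T.tailStabilizer i))
    (hl : l.IsChain fun a b =>
      a.2 ∈ HNNExtension.toSubgroup (T.conjEdgeSubgroup i t) (T.edgeSubgroup i) a.1 → a.1 = b.1) :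
    (l.head?.map Prod.fst = some 1 → T.wordValue t l ∈ T.beyond i (T.edge i)) ∧
    (l.head?.map Prod.fst = some (-1) → ∃ w : G, T.wordValue t l = t⁻¹ * w ∧
      (w ∈ MulAction.stabilizer G (T.edge i) ∨ w ∈ T.beyond i (T.star (T.edge i)))) := by
  have ht' : t⁻¹ • T.collapsedEnd i false = T.collapsedEnd i true := by
    rw [← ht, inv_smul_smul]
  induction l with
  | nil => simp
  | cons x l ih =>
    obtain ⟨u, a⟩ := x
    have ha : (a : G) • T.collapsedEnd i true = T.collapsedEnd i true := a.2
    have hval : T.wordValue t ((u, a) :: l) = t ^ (u : ℤ) * (a * T.wordValue t l) := by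
      simp [wordValue, mul_assoc]
    rw [hval]
    obtain ⟨ih₁, ih₂⟩ := ih (List.isChain_cons.1 hl).2
    have hch := (List.isChain_cons.1 hl).1
    rcases Int.units_eq_one_or u with rfl | rfl
    · refine ⟨fun _ => ?_, fun h => absurd h (by simp)⟩
      rw [Units.val_one, zpow_one, ← mul_assoc]
      have hta : T.edge i < (t * a) • T.edge i :=
        T.lt_smul_of_smul_tail (by rw [mul_smul, ha, ht])
      rcases l with - | ⟨⟨u', a'⟩, l⟩
      · exact T.mul_stabilizer_mem_beyond (b := false) hta (Subgroup.one_mem _)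
      · rcases Int.units_eq_one_or u' with rfl | rfl
        · exact T.mul_mem_beyond hta.le (ih₁ rfl)
        · obtain ⟨w, hw, hw'⟩ := ih₂ rfl
          rw [hw, ← mul_assoc]
          have hna : t * a * t⁻¹ ∉ MulAction.stabilizer G (T.edge i) := fun h => by
            have := hch (-1, a') rfl h
            exact absurd this (by simp)
          have hb : T.edge i < (t * a * t⁻¹) • T.star (T.edge i) :=
            (T.towards_lt_of_smul_collapsedEnd (i := i) (b := false) (c := false) (by
              rw [mul_smul, mul_smul, ht', ha, ht])).resolve_left fun h => hna h.2
          rcases hw' with hw' | hw'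
          · exact T.mul_stabilizer_mem_beyond (b := true) hb hw'
          · exact T.mul_mem_beyond hb.le hw'
    · refine ⟨fun h => absurd h (by simp), fun _ => ⟨_, by rw [Units.val_neg, Units.val_one,
        zpow_neg, zpow_one], ?_⟩⟩
      rcases l with - | ⟨⟨u', a'⟩, l⟩
      · rw [show T.wordValue t [] = 1 from rfl, mul_one]
        refine (T.mem_stabilizer_or_mem_beyond ha).imp id fun h => Or.inl h
      · rcases Int.units_eq_one_or u' with rfl | rfl
        · right
          have hna : (a : G) ∉ MulAction.stabilizer G (T.edge i) := fun h => by
            have := hch (1, a') rfl h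
            exact absurd this (by simp)
          exact T.mul_mem_beyond ((T.mem_stabilizer_or_mem_beyond ha).resolve_left hna).le (ih₁ rfl)
        · obtain ⟨w, hw, hw'⟩ := ih₂ rfl
          right
          rw [hw, ← mul_assoc]
          exact T.mul_mem_beyond_of_smul_head (by rw [mul_smul, ht', ha]) hw'

theorem hnnHom_prod (w : HNNExtension.NormalWord.ReducedWord (T.tailStabilizer i)
    (T.conjEdgeSubgroup i t) (T.edgeSubgroup i)) :
    T.hnnHom ht (w.prod (T.conjEquiv ht)) = w.head * T.wordValue t w.toList := by
  rw [HNNExtension.NormalWord.ReducedWord.prod, map_mul, HNNExtension.lift_of, map_list_prod,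
    List.map_map, wordValue]
  congr 2
  refine List.map_congr_left fun x _ => ?_
  simp

/-- An HNN reduced word carries the edge beyond its head if it starts with an element of the edge
group followed by `t`. -/
theorem hnnHom_prod_mem_beyond (w : HNNExtension.NormalWord.ReducedWord (T.tailStabilizer i)
    (T.conjEdgeSubgroup i t) (T.edgeSubgroup i)) (h : w.head ∈ T.edgeSubgroup i)
    (h' : w.toList.head?.map Prod.fst = some 1) :
    T.hnnHom ht (w.prod (T.conjEquiv ht)) ∈ T.beyond i (T.edge i) := by
  rw [hnnHom_prod]
  refine T.mul_mem_beyond (q := T.edge i) ?_ ((T.wordValue_spec ht _ w.chain).1 h')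
  have h1 : (w.head : G) • T.edge i = T.edge i := h
  rw [h1]

/-- A reduced word that does not start with an element of the edge group followed by `t` carries
the edge beyond its tail, unless it is an element of the edge group. -/
theorem hnnHom_prod_mem_beyond_star (w : HNNExtension.NormalWord.ReducedWord (T.tailStabilizer i)
    (T.conjEdgeSubgroup i t) (T.edgeSubgroup i))
    (h : ¬ (w.head ∈ T.edgeSubgroup i ∧ w.toList.head?.map Prod.fst = some 1)) :
    (w.toList = [] ∧ w.head ∈ T.edgeSubgroup i) ∨
      T.hnnHom ht (w.prod (T.conjEquiv ht)) ∈ T.beyond i (T.star (T.edge i)) := by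
  have hhead : (w.head : G) • T.collapsedEnd i true = T.collapsedEnd i true := w.head.2
  have hspec := T.wordValue_spec ht _ w.chain
  rw [hnnHom_prod]
  rcases hl : w.toList with - | ⟨⟨u, a⟩, l⟩
  · refine (T.mem_stabilizer_or_mem_beyond hhead).imp (fun h => ⟨rfl, h⟩) fun h' => ?_
    rw [show T.wordValue t [] = 1 from rfl, mul_one]
    exact Or.inl h'
  · right
    rw [hl] at h hspec
    rcases Int.units_eq_one_or u with rfl | rfl
    · have hn : (w.head : G) ∉ MulAction.stabilizer G (T.edge i) := fun h' => h ⟨h', rfl⟩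
      exact T.mul_mem_beyond ((T.mem_stabilizer_or_mem_beyond hhead).resolve_left hn).le
        (hspec.1 rfl)
    · obtain ⟨x, hx, hx'⟩ := hspec.2 rfl
      rw [hx, ← mul_assoc]
      exact T.mul_mem_beyond_of_smul_head (by rw [mul_smul, ← ht, inv_smul_smul, hhead]) hx'

/-- Reduced words represent all elements of the HNN extension, since words in normal form do. -/
theorem exists_reducedWord (x : HNNExtension (T.tailStabilizer i) (T.conjEdgeSubgroup i t)
    (T.edgeSubgroup i) (T.conjEquiv ht)) :
    ∃ w : HNNExtension.NormalWord.ReducedWord (T.tailStabilizer i) (T.conjEdgeSubgroup i t)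
      (T.edgeSubgroup i), w.prod (T.conjEquiv ht) = x := by
  obtain ⟨d⟩ := HNNExtension.NormalWord.TransversalPair.nonempty (T.tailStabilizer i)
    (T.conjEdgeSubgroup i t) (T.edgeSubgroup i)
  obtain ⟨w, rfl⟩ := (HNNExtension.NormalWord.equiv (T.conjEquiv ht) d).symm.surjective x
  exact ⟨w.toReducedWord, rfl⟩

theorem hnnHom_injective : Function.Injective (T.hnnHom ht) := by
  refine (injective_iff_map_eq_one _).2 fun x hx => ?_
  obtain ⟨w, rfl⟩ := T.exists_reducedWord ht x
  have hone := fun b => T.notMem_beyond_of_mem_stabilizer (i := i) (Subgroup.one_mem _) b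
  by_cases h : w.head ∈ T.edgeSubgroup i ∧ w.toList.head?.map Prod.fst = some 1
  · have := T.hnnHom_prod_mem_beyond ht w h.1 h.2
    rw [hx] at this
    exact absurd this (hone false)
  · rcases T.hnnHom_prod_mem_beyond_star ht w h with ⟨hl, -⟩ | h'
    · rw [hnnHom_prod, hl, show T.wordValue t [] = 1 from rfl, mul_one] at hx
      rw [HNNExtension.NormalWord.ReducedWord.prod, hl, show w.head = 1 from Subtype.ext hx]
      simp
    · rw [hx] at h'
      exact absurd h' (hone true)

theorem hnnHom_surjective : Function.Surjective (T.hnnHom ht) := by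
  rw [← MonoidHom.range_eq_top]
  have hA : T.tailStabilizer i ≤ (T.hnnHom ht).range := fun a ha =>
    ⟨HNNExtension.of ⟨a, ha⟩, HNNExtension.lift_of _ _ _ _⟩
  have htr : t ∈ (T.hnnHom ht).range := ⟨HNNExtension.t, HNNExtension.lift_t _ _ _⟩
  refine T.eq_top_of_stabilizer_le (i := i) _ (fun b x hx => ?_) fun x hx => ?_
  · cases b
    · have : t⁻¹ * x * t ∈ (T.hnnHom ht).range := hA (by
        rw [MulAction.mem_stabilizer_iff] at hx ⊢
        rw [mul_smul, mul_smul, ht, hx, ← ht, inv_smul_smul])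
      have := Subgroup.mul_mem _ (Subgroup.mul_mem _ htr this) (Subgroup.inv_mem _ htr)
      simpa [mul_assoc] using this
    · exact hA hx
  · have : t⁻¹ * x ∈ (T.hnnHom ht).range := hA (by
      rw [MulAction.mem_stabilizer_iff, mul_smul, hx, ← ht, inv_smul_smul])
    simpa using Subgroup.mul_mem _ htr this

/-- The splitting of `G` obtained from the collapsed tree if `t` carries the tail of the chosen edge
to its head. -/
def hnnSplitting : HNNSplitting G where
  vertex := T.tailStabilizer i
  C₀ := T.conjEdgeSubgroup i t
  C₁ := T.edgeSubgroup i
  φ := T.conjEquiv ht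
  t := t
  conj_t := T.conjEquiv_comm ht
  bijective := ⟨T.hnnHom_injective ht, T.hnnHom_surjective ht⟩

theorem baseSet_hnnSplitting : (Splitting.hnn (T.hnnSplitting ht)).baseSet =
    T.beyond i (T.edge i) := by
  ext g
  constructor
  · rintro ⟨w, h, h', rfl⟩
    exact T.hnnHom_prod_mem_beyond ht w h h'
  · intro hg
    obtain ⟨x, rfl⟩ := T.hnnHom_surjective ht g
    obtain ⟨w, rfl⟩ := T.exists_reducedWord ht x
    by_cases h : w.head ∈ T.edgeSubgroup i ∧ w.toList.head?.map Prod.fst = some 1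
    · exact ⟨w, h.1, h.2, rfl⟩
    · rcases T.hnnHom_prod_mem_beyond_star ht w h with ⟨hl, h'⟩ | h'
      · rw [hnnHom_prod, hl, show T.wordValue t [] = 1 from rfl, mul_one] at hg
        exact absurd hg (T.notMem_beyond_of_mem_stabilizer h' false)
      · exact absurd h' (T.notMem_beyond_star hg)

theorem edge_hnnSplitting : (Splitting.hnn (T.hnnSplitting ht)).edge =
    MulAction.stabilizer G (T.edge i) := by
  change (T.edgeSubgroup i).map (T.tailStabilizer i).subtype = _
  rw [Subgroup.subgroupOf_map_subtype]
  exact inf_eq_left.2 (T.stabilizer_edge_le true)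

end HNN

section Collapse

variable {G ι P : Type*} [Group G] [PartialOrder P] [MulAction G P] (T : TreeOrder G ι P) (i : ι)

/-- A path through edges of colors other than `i` does not move the vertices of the collapsed
tree. -/
theorem restrict_rep_of_isPath {v w : T.Orbit} {x : T.graph.PathGroup}
    (hx : T.graph.IsPath {i}ᶜ v w x) :
    T.restrict i (T.rep v).1 = T.toGroup x • T.restrict i (T.rep w).1 := by
  have hedge : ∀ (j : ι) (b : Bool), j ≠ i → T.restrict i (T.rep (T.origin j b)).1 =
      T.toGroup (T.directedLetter j b) • T.restrict i (T.rep (T.origin j !b)).1 := by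
    intro j b hj
    rw [← restrict_smul, ← Vertex.coe_smul, ← headVertex_directedEdge,
      ← headVertex_star_directedEdge]
    exact T.restrict_head_star (by rwa [color_directedEdge])
  induction hx with
  | vertex v a =>
    rw [toGroup_ofVertex, ← restrict_smul, ← Vertex.coe_smul, vertexHom_smul]
  | edge e he => exact hedge e true he
  | edge_inv e he => exact hedge e false he
  | comp _ _ ih₁ ih₂ => rw [ih₁, ih₂, map_mul, mul_smul]

/-- Conversely, elements that do not move a vertex of the collapsed tree come from paths through
edges of colors other than `i`. -/
theorem exists_isPath_of_restrict_eq {v w : T.Orbit} {g : G}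
    (h : T.restrict i (T.rep v).1 = g • T.restrict i (T.rep w).1) :
    ∃ x, T.graph.IsPath {i}ᶜ v w x ∧ T.toGroup x = g := by
  obtain ⟨x, hx, hg⟩ := T.exists_isPath (S := {i}ᶜ) (v := v) (w := w) (g := 1) (h := g)
    fun e he he' hc => he' (by
      rw [one_smul]
      rw [← restrict_smul] at h
      have : e ∈ T.restrict i (g • (T.rep w).1) := ⟨he, hc⟩
      exact (h ▸ this : e ∈ T.restrict i (T.rep v).1).1)
  exact ⟨x, hx, by rw [← hg, one_mul]⟩

theorem collapsedEnd_eq (b : Bool) : T.collapsedEnd i b =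
    T.mover (T.endpoint i b) • T.restrict i (T.rep (T.origin i b)).1 := by
  rw [← restrict_smul, ← Vertex.coe_smul]
  cases b
  · exact congrArg (fun x : T.Vertex => T.restrict i x.1) (T.mover_smul (T.endpoint i false)).symm
  · exact congrArg (fun x : T.Vertex => T.restrict i x.1) (T.mover_smul (T.endpoint i true)).symm

/-- The fundamental group of a component of the quotient graph without the edge `i` is the
stabilizer of a vertex of the collapsed tree. -/
theorem transport_loops {v₀ : T.Orbit} {p : T.graph.PathGroup} {b : Bool}
    (hp : T.graph.IsPath Set.univ v₀ (T.origin i b) p)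
    (hp' : T.toGroup p = T.mover (T.endpoint i b)) :
    T.graph.transport (T.fundamentalGroupEquiv v₀) p (T.graph.loops {i}ᶜ (T.origin i b)) =
      MulAction.stabilizer G (T.collapsedEnd i b) := by
  ext g
  rw [T.mem_transport hp fun x hx => GraphOfGroups.IsPath.mono (Set.subset_univ _) hx, hp',
    collapsedEnd_eq, MulAction.mem_stabilizer_iff]
  constructor
  · rintro ⟨x, hx, rfl⟩
    rw [mul_smul, mul_smul, inv_smul_smul, ← T.restrict_rep_of_isPath i hx]
  · intro hg
    obtain ⟨x, hx, h⟩ := T.exists_isPath_of_restrict_eq i (v := T.origin i b) (w := T.origin i b)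
      (g := (T.mover (T.endpoint i b))⁻¹ * g * T.mover (T.endpoint i b)) (by
        rw [mul_smul, mul_smul, hg, inv_smul_smul])
    exact ⟨x, hx, by rw [h]; group⟩

theorem transport_edgeImage {v₀ : T.Orbit} {p : T.graph.PathGroup}
    (hp : T.graph.IsPath Set.univ v₀ (T.graph.src i) p)
    (hp' : T.toGroup p = T.mover (T.endpoint i true)) :
    T.graph.transport (T.fundamentalGroupEquiv v₀) p (T.graph.edgeImage i) =
      MulAction.stabilizer G (T.edge i) := by
  ext g
  rw [T.mem_transport hp (by rintro _ ⟨c, rfl⟩; exact .vertex _ _), hp']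
  constructor
  · rintro ⟨_, ⟨c, rfl⟩, rfl⟩
    rw [MonoidHom.comp_apply, toGroup_ofVertex, vertexHom_srcHom]
    have := T.edgeHom_smul i c
    rw [MulAction.mem_stabilizer_iff]
    simpa [mul_assoc] using this
  · intro hg
    obtain ⟨c, rfl⟩ := T.exists_edgeHom hg
    refine ⟨_, ⟨c, rfl⟩, ?_⟩
    rw [MonoidHom.comp_apply, toGroup_ofVertex, vertexHom_srcHom]
    group

/-- Collapsing all edges of the quotient graph of groups but `i` yields a splitting over the
stabilizer of the chosen edge of color `i`. One of its standard sets consists of the elements that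
carry this edge beyond its tail, possibly with the stabilizer added. -/
theorem exists_splitting (v₀ : T.Orbit)
    (hproper : ∀ b, MulAction.stabilizer G (T.collapsedEnd i b) ≠ ⊤) :
    ∃ s : Splitting G, T.graph.CollapsesTo (T.fundamentalGroupEquiv v₀) i s ∧
      s.edge = MulAction.stabilizer G (T.edge i) ∧
      ∃ Y, s.IsStandardSet Y ∧ T.beyond i (T.star (T.edge i)) ⊆ Y ∧
        Y ⊆ (T.beyond i (T.edge i))ᶜ := by
  obtain ⟨p, hp, hp'⟩ := T.exists_isPath (S := Set.univ) (v := v₀) (w := T.graph.src i)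
    (g := 1) (h := T.mover (T.endpoint i true)) fun _ _ _ => Set.mem_univ _
  rw [one_mul] at hp'
  by_cases hi : ∃ x : G, x • T.collapsedEnd i true = T.collapsedEnd i false
  · obtain ⟨x, hx⟩ := hi
    obtain ⟨q, hq, hq'⟩ := T.exists_isPath_of_restrict_eq i (v := T.graph.tgt i)
      (w := T.graph.src i)
      (g := (T.mover (T.endpoint i false))⁻¹ * x * T.mover (T.endpoint i true)) (by
        rw [mul_smul, mul_smul, eq_inv_smul_iff]
        rw [collapsedEnd_eq, collapsedEnd_eq] at hx
        exact hx.symm)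
    have hloop : T.graph.IsPath Set.univ v₀ v₀ (p * T.graph.letter i * q * p⁻¹) :=
      ((hp.comp (.edge i (Set.mem_univ i))).comp (hq.mono (Set.subset_univ _))).comp hp.inv
    refine ⟨.hnn (T.hnnSplitting hx), ⟨p, q, hp, hq, ?_, ?_, ⟨_, hloop⟩, rfl, ?_⟩,
      T.edge_hnnSplitting hx, _, Or.inr (Or.inr (Or.inl rfl)), ?_, ?_⟩
    · exact (T.transport_loops i (b := true) hp hp').symm
    · rw [T.transport_edgeImage i hp hp']
      exact T.edge_hnnSplitting hx
    · change T.toGroup (p * T.graph.letter i * q * p⁻¹) = x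
      rw [map_mul, map_mul, map_mul, map_inv, toGroup_letter, hp', hq', letterValue]
      group
    · rw [T.baseSet_hnnSplitting hx]
      exact fun g hg hg' => T.notMem_beyond_star hg' hg
    · rw [T.baseSet_hnnSplitting hx]
  · refine ⟨.amalgam (T.amalgamSplitting i hi hproper), ⟨?_, p, hp, ?_, ?_, ?_⟩, rfl, _,
      Or.inl rfl, ?_, ?_⟩
    · rintro ⟨q, hq⟩
      refine hi ⟨T.mover (T.endpoint i false) * T.toGroup q * (T.mover (T.endpoint i true))⁻¹, ?_⟩
      rw [collapsedEnd_eq, collapsedEnd_eq, mul_smul, mul_smul, inv_smul_smul]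
      exact congrArg _ (T.restrict_rep_of_isPath i hq).symm
    · exact (T.transport_loops i (b := true) hp hp').symm
    · refine (T.transport_loops i (b := false) (hp.comp (.edge i (Set.mem_univ i))) ?_).symm
      rw [map_mul, hp', toGroup_letter, letterValue, mul_inv_cancel_left]
    · exact (T.transport_edgeImage i hp hp').symm
    · exact (T.reducedSet_eq hi true).ge
    · exact fun g hg hg' => T.notMem_beyond_star hg' ((T.reducedSet_eq hi true).le hg)

end Collapse

end TreeOrder
end AlmostInvariant

/-! ### The oriented edges given by a family of almost invariant sets -/

namespace AlmostInvariant

section Sides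

theorem side_not {G : Type*} (U : Set G) (a : Bool) : side U (!a) = (side U a)ᶜ := by
  cases a
  · exact (compl_compl U).symm
  · rfl

theorem side_side {G : Type*} (U : Set G) (a b : Bool) : side (side U a) b = side U (a == b) := by
  cases a <;> cases b <;> simp [side]

variable {G : Type*} [Group G] {U : Set G}

theorem side_smul (g : G) (U : Set G) (a : Bool) : side (g • U) a = g • side U a := by
  cases a
  · exact Set.smul_set_compl.symm
  · rfl

theorem stabilizer_side (U : Set G) (a : Bool) :
    MulAction.stabilizer G (side U a) = MulAction.stabilizer G U := by
  cases a
  · exact stabilizer_compl G G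
  · rfl

theorem IsNontrivialAlmostInvariant.side {H : Subgroup G} (h : IsNontrivialAlmostInvariant H U)
    (a : Bool) : IsNontrivialAlmostInvariant H (side U a) := by
  cases a
  · exact h.compl
  · exact h

theorem Essential.side (h : Essential U) (a : Bool) : Essential (side U a) := by
  cases a
  · exact h.compl
  · exact h

end Sides

/-- The oriented edges of the tree associated to a family `X` of sets: the translates of the sets
`X i` together with an orientation. Equal translates of different `X i` give different edges, and so
do the two orientations even if a translate is equal to the complement of another one. -/
@[ext]
structure Edge {G ι : Type*} [Group G] (X : ι → Set G) where
  color : ι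
  carrier : Set G
  positive : Bool
  exists_smul : ∃ g : G, carrier = g • X color

namespace Edge

variable {G : Type u} [Group G] {k : ℕ} {H : Fin k → Subgroup G} {X : Fin k → Set G}

instance : MulAction G (Edge X) where
  smul g e := ⟨e.color, g • e.carrier, e.positive, by
    obtain ⟨x, hx⟩ := e.exists_smul
    exact ⟨g * x, by rw [hx, mul_smul]⟩⟩
  one_smul e := Edge.ext rfl (one_smul G e.carrier) rfl
  mul_smul g h e := Edge.ext rfl (mul_smul g h e.carrier) rfl

/-- The translate of `X i`, or its complement, that belongs to an oriented edge. -/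
def toSet (e : Edge X) : Set G := side e.carrier e.positive

/-- The edge with the opposite orientation. -/
def star (e : Edge X) : Edge X := ⟨e.color, e.carrier, !e.positive, e.exists_smul⟩

/-- The edge given by the set `X i` itself. -/
def ofIndex (X : Fin k → Set G) (i : Fin k) : Edge X := ⟨i, X i, true, 1, (one_smul G _).symm⟩

/-- The position of an edge among all edges with the same set. It changes its sign if the orientation
is reversed and is never zero. -/
def key (e : Edge X) : ℤ := bif e.positive then e.color + 1 else -(e.color + 1)

theorem toSet_star (e : Edge X) : e.star.toSet = e.toSetᶜ := side_not _ _

theorem star_star (e : Edge X) : e.star.star = e := Edge.ext rfl rfl (Bool.not_not _)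

theorem toSet_smul (g : G) (e : Edge X) : (g • e).toSet = g • e.toSet := side_smul _ _ _

theorem key_star (e : Edge X) : e.star.key = -e.key := by
  cases h : e.positive <;> simp [key, star, h]

/-- An edge is determined by its set and its key, as the key gives the index and the orientation. -/
theorem ext_key {e f : Edge X} (h : e.toSet = f.toSet) (h' : e.key = f.key) : e = f := by
  obtain ⟨i, U, a, hU⟩ := e
  obtain ⟨j, V, b, hV⟩ := f
  simp only [key, toSet] at h h'
  cases a <;> cases b <;> simp only [cond_true, cond_false] at h'
  · obtain rfl : i = j := Fin.ext (by omega)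
    exact Edge.ext rfl (compl_injective h) rfl
  · omega
  · omega
  · obtain rfl : i = j := Fin.ext (by omega)
    exact Edge.ext rfl h rfl

theorem essential (hX : ∀ i, Essential (X i)) (e : Edge X) : Essential e.toSet := by
  obtain ⟨g, hg⟩ := e.exists_smul
  rw [toSet, hg]
  exact ((hX _).smul g).side _

/-- The order of the oriented edges is the order of their sets, where edges with equal sets are
ordered by their keys. -/
abbrev partialOrder (hX : ∀ i, Essential (X i)) : PartialOrder (Edge X) where
  le e f := CornerLE e.toSet f.toSet ∧ (e.toSet = f.toSet → e.key ≤ f.key)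
  le_refl e := ⟨.of_subset subset_rfl, fun _ => le_rfl⟩
  le_trans e f g hef hfg := by
    refine ⟨hef.1.trans (e.essential hX) (f.essential hX) (g.essential hX) hfg.1, fun h => ?_⟩
    have hfe : CornerLE f.toSet e.toSet := h ▸ hfg.1
    have heq := hef.1.antisymm hfe
    exact (hef.2 heq).trans (hfg.2 (heq.symm.trans h))
  le_antisymm e f hef hfe :=
    have heq := hef.1.antisymm hfe.1
    ext_key heq (le_antisymm (hef.2 heq) (hfe.2 heq.symm))

theorem mem_translates (e : Edge X) :
    ∃ g : G, e.carrier = g • X e.color ∧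
      ((MulAut.conj g • H e.color, e.toSet) : Subgroup G × Set G) ∈ translates H X := by
  obtain ⟨g, hg⟩ := e.exists_smul
  exact ⟨g, hg, e.color, g, e.positive, by rw [toSet, hg]⟩

theorem finiteOver_conj_iff (hX : ∀ i, IsNontrivialAlmostInvariant (H i) (X i)) (e : Edge X) {g : G}
    (hg : e.carrier = g • X e.color) {S : Set G} :
    FiniteOver (MulAut.conj g • H e.color) S ↔ FiniteOver (MulAction.stabilizer G e.toSet) S := by
  have hs : MulAction.stabilizer G e.toSet =
      MulAut.conj g • MulAction.stabilizer G (X e.color) := by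
    rw [toSet, stabilizer_side, hg]
    exact MulAction.stabilizer_smul_eq_stabilizer_map_conj g _
  rw [hs, finiteOver_conj, finiteOver_conj, (hX _).finiteOver_stabilizer_iff]

theorem subset_or_subset (hX : ∀ i, IsNontrivialAlmostInvariant (H i) (X i))
    (hpair : ∀ p ∈ translates H X, ∀ q ∈ translates H X, SmallPairHasEmpty p.1 p.2 q.2)
    {e f : Edge X} (h : AlmostLE e.toSet f.toSet) (h' : AlmostLE f.toSet e.toSet) :
    e.toSet ⊆ f.toSet ∨ f.toSet ⊆ e.toSet := by
  have hess := fun i => (hX i).of_stabilizer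
  obtain ⟨g, hg, he⟩ := e.mem_translates (H := H)
  obtain ⟨_, _, hf⟩ := f.mem_translates (H := H)
  have h₁ : corner e.toSet f.toSet true false = e.toSet ∩ f.toSetᶜ := rfl
  have h₂ : corner e.toSet f.toSet false true = f.toSet ∩ e.toSetᶜ := Set.inter_comm _ _
  have := hpair _ he _ hf true false false true (by simp)
    ((e.finiteOver_conj_iff hX hg).2 h)
    ((e.finiteOver_conj_iff hX hg).2 <| by
      rw [h₂]
      exact h'.finiteOver (f.essential hess) (e.essential hess))
  rw [h₁, h₂] at this
  exact this.imp (fun h => Set.sdiff_eq_empty.1 (by rwa [Set.sdiff_eq]))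
    fun h => Set.sdiff_eq_empty.1 (by rwa [Set.sdiff_eq])

theorem exists_almostLE (hX : ∀ i, IsNontrivialAlmostInvariant (H i) (X i))
    (hnest : AlmostNested (translates H X)) (e f : Edge X) :
    ∃ e' f' : Edge X, (e' = e ∨ e' = e.star) ∧ (f' = f ∨ f' = f.star) ∧
      AlmostLE e'.toSet f'.toSet := by
  obtain ⟨g, hg, he⟩ := e.mem_translates (H := H)
  obtain ⟨_, _, hf⟩ := f.mem_translates (H := H)
  obtain ⟨a, b, h⟩ := hnest _ he _ hf
  replace h := (e.finiteOver_conj_iff hX hg).1 h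
  have key : ∀ (x : Edge X) (c : Bool), ∃ x' : Edge X, (x' = x ∨ x' = x.star) ∧
      x'.toSet = side x.toSet c := by
    intro x c
    cases c
    · exact ⟨x.star, Or.inr rfl, x.toSet_star⟩
    · exact ⟨x, Or.inl rfl, rfl⟩
  obtain ⟨e', he', hea⟩ := key e a
  obtain ⟨f', hf', hfb⟩ := key f (!b)
  refine ⟨e', f', he', hf', ?_⟩
  rw [AlmostLE, hea, hfb, side_not, compl_compl, stabilizer_side]
  exact h

/-- There is a point that lies in a given set of the family and in all larger ones. If a larger set
does not contain the given one, then all four of their corners are non-empty; so there are only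
finitely many such sets modulo `H i`, and a point outside finitely many small corners will do. -/
theorem exists_mem_of_cornerLE [Group.FG G] (hH : ∀ i, (H i).FG)
    (hX : ∀ i, IsNontrivialAlmostInvariant (H i) (X i)) (e : Edge X) :
    ∃ u ∈ e.toSet, ∀ f : Edge X, CornerLE e.toSet f.toSet → u ∈ f.toSet := by
  have hess := fun i => (hX i).of_stabilizer
  obtain ⟨i, Z, a, ⟨g, hg⟩⟩ := e
  -- it suffices to consider `X i` and its complement
  suffices h : ∃ u ∈ side (X i) a, ∀ f : Edge X, CornerLE (side (X i) a) f.toSet → u ∈ f.toSet by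
    obtain ⟨u, hu, h⟩ := h
    have hZ : (⟨i, Z, a, ⟨g, hg⟩⟩ : Edge X).toSet = g • side (X i) a := by
      rw [← side_smul, ← hg]; rfl
    rw [hZ]
    refine ⟨g • u, Set.smul_mem_smul_set hu, fun f hf => ?_⟩
    have := h (g⁻¹ • f) (by rw [toSet_smul]; simpa using hf.smul g⁻¹)
    rwa [toSet_smul, Set.mem_smul_set_iff_inv_smul_mem, inv_inv] at this
  have hU := (hX i).side a
  have hUess : Essential (side (X i) a) := Essential.side (hess i) a
  have hC := fun j => exists_finite_not_nested (hH i) (hH j) hU.1 (hX j).1 hU.nonempty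
    hU.compl.nonempty
  choose C hC hnested using hC
  let I : Set (Fin k × G × Bool) := {x | x.2.1 ∈ C x.1 ∧
    FiniteOver (H i) (side (X i) a ∩ side (x.2.1 • X x.1) x.2.2)}
  have hI : I.Finite := by
    have := Set.finite_univ (α := Fin k) |>.prod
      (((Set.finite_univ (α := Fin k)).biUnion fun j _ => hC j).prod (Set.finite_univ (α := Bool)))
    refine this.subset ?_
    rintro ⟨j, c, b⟩ ⟨hc, -⟩
    exact ⟨Set.mem_univ _, Set.mem_biUnion (Set.mem_univ j) hc, Set.mem_univ _⟩
  obtain ⟨F, hF, hbad⟩ := FiniteOver.biUnion hI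
    (f := fun x => side (X i) a ∩ side (x.2.1 • X x.1) x.2.2) fun x hx => hx.2
  obtain ⟨u, hu, huF⟩ := exists_mem_of_not_finiteOver hU.2.1 ⟨F, hF, subset_rfl⟩
  refine ⟨u, hu, fun f hf => ?_⟩
  by_contra huf
  -- now all four corners are non-empty, so that the larger set is one of finitely many modulo `H i`
  have hfess := f.essential hess
  obtain ⟨j, W, b, ⟨x, rfl⟩⟩ := f
  have hsmall : FiniteOver (H i) (side (X i) a ∩ side (x • X j) !b) := by
    have := hf.1
    rw [AlmostLE, stabilizer_side, (hX i).finiteOver_stabilizer_iff] at this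
    rwa [side_not]
  generalize hV : (⟨j, x • X j, b, ⟨x, rfl⟩⟩ : Edge X).toSet = V at *
  have hV' : side (x • X j) b = V := hV
  have hne : ¬ ∃ c d, corner (side (X i) a) (x • X j) c d = ∅ := by
    rintro ⟨c, d, hcd⟩
    have hd : side (x • X j) d = side V (b == d) := by
      rw [← hV', side_side]
      cases b <;> cases d <;> rfl
    rw [corner, hd, Set.eq_empty_iff_forall_notMem] at hcd
    cases c <;> cases hbd : (b == d) <;> rw [hbd] at hcd
    · have h1 : Vᶜ ⊆ side (X i) a := fun y hy => by
        by_contra hy'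
        exact hcd y ⟨hy', hy⟩
      exact not_almostLE_compl hfess.compl (.of_subset h1) (hf.1.compl hUess hfess)
    · have h1 : V ⊆ side (X i) a := fun y hy => by
        by_contra hy'
        exact hcd y ⟨hy', hy⟩
      exact huf (hf.2 (.of_subset h1) hu)
    · exact hcd u ⟨hu, huf⟩
    · have h1 : side (X i) a ⊆ Vᶜ := fun y hy hy' =>
        hcd y ⟨hy, hy'⟩
      exact not_almostLE_compl hUess hf.1 (.of_subset h1)
  obtain ⟨_, ⟨h, hh, c, hc, rfl⟩, l, hl, rfl⟩ := (hnested j x).resolve_left hne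
  have hx : side ((h * c * l) • X j) (!b) = h • side (c • X j) (!b) := by
    rw [mul_smul, (hX j).1.1 l hl, mul_smul, side_smul]
  have hcor : h⁻¹ • (side (X i) a ∩ side ((h * c * l) • X j) !b) =
      side (X i) a ∩ side (c • X j) !b := by
    rw [Set.smul_set_inter, hx, inv_smul_smul, hU.1.1 _ ((H i).inv_mem hh)]
  have hmem : h⁻¹ • u ∈ side (X i) a ∩ side (c • X j) !b := by
    rw [← hcor]
    refine Set.smul_mem_smul_set ⟨hu, ?_⟩
    rw [side_not]
    exact fun h' => huf (hV' ▸ h')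
  have hIx : (j, c, !b) ∈ I := ⟨hc, hcor ▸ FiniteOver.smul_of_mem ((H i).inv_mem hh) hsmall⟩
  obtain ⟨y, hy, f, hf, hyf⟩ := hbad (Set.mem_biUnion hIx hmem)
  refine huF ⟨h * y, (H i).mul_mem hh hy, f, hf, ?_⟩
  simp only [smul_eq_mul] at hyf ⊢
  rw [mul_assoc, hyf, mul_inv_cancel_left]

/-- Only finitely many edges separate two elements of `G`. -/
theorem finite_separating (hX : ∀ i, IsNontrivialAlmostInvariant (H i) (X i)) (u v : G) :
    {e : Edge X | u ∈ e.toSet ∧ v ∉ e.toSet}.Finite := by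
  have key : ∀ (u v : G) (i : Fin k),
      {W : Set G | ∃ g : G, W = g • X i ∧ u ∈ W ∧ v ∉ W}.Finite := by
    intro u v i
    obtain ⟨F, hF, hb⟩ := (hX i).1.finiteOver_boundary (u⁻¹ * v)
    refine (hF.image fun f => (u * f⁻¹) • X i).subset ?_
    rintro _ ⟨g, rfl, hu, hv⟩
    rw [Set.mem_smul_set_iff_inv_smul_mem, smul_eq_mul] at hu hv
    obtain ⟨h, hh, f, hf, hhf⟩ := hb (show g⁻¹ * u ∈ _ by
      rw [Set.mem_ofPred_eq, show g⁻¹ * u * (u⁻¹ * v) = g⁻¹ * v by group]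
      exact fun h => hv (h.2 hu))
    refine ⟨f, hf, ?_⟩
    have hg : u * f⁻¹ = g * h := by
      simp only at hhf
      rw [mul_inv_eq_iff_eq_mul, mul_assoc, hhf, mul_inv_cancel_left]
    simp only [hg]
    rw [mul_smul, (hX i).1.1 h hh]
  have hfin : (⋃ i ∈ (Set.univ : Set (Fin k)),
      ({W : Set G | ∃ g : G, W = g • X i ∧ u ∈ W ∧ v ∉ W} ∪
        {W : Set G | ∃ g : G, W = g • X i ∧ v ∈ W ∧ u ∉ W})).Finite :=
    Set.finite_univ.biUnion fun i _ => (key u v i).union (key v u i)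
  have hinj : Function.Injective fun e : Edge X => (e.color, e.carrier, e.positive) := by
    intro e f h
    simp only [Prod.mk.injEq] at h
    exact Edge.ext h.1 h.2.1 h.2.2
  refine ((Set.finite_univ.prod (hfin.prod Set.finite_univ)).preimage hinj.injOn).subset ?_
  rintro ⟨i, W, a, hW⟩ ⟨hu, hv⟩
  refine ⟨Set.mem_univ _, Set.mem_biUnion (Set.mem_univ i) ?_, Set.mem_univ _⟩
  obtain ⟨g, hg⟩ := hW
  cases a
  · exact Or.inr ⟨g, hg, not_not.1 hv, hu⟩
  · exact Or.inl ⟨g, hg, hu, hv⟩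

end Edge

end AlmostInvariant

/-! ### The decomposition of the group -/

namespace AlmostInvariant
namespace Edge

variable {G : Type u} [Group G] {k : ℕ} {H : Fin k → Subgroup G} {X : Fin k → Set G}

/-- The translates of the sets `X i` and their complements form the oriented edges of a tree. -/
abbrev treeOrder [Group.FG G] (hH : ∀ i, (H i).FG)
    (hX : ∀ i, IsNontrivialAlmostInvariant (H i) (X i)) (hnest : AlmostNested (translates H X))
    (hpair : ∀ p ∈ translates H X, ∀ q ∈ translates H X, SmallPairHasEmpty p.1 p.2 q.2) :
    letI := partialOrder fun i => (hX i).of_stabilizer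
    TreeOrder G (Fin k) (Edge X) :=
  letI := partialOrder fun i => (hX i).of_stabilizer
  have hess := fun e : Edge X => e.essential fun i => (hX i).of_stabilizer
  have star_le : ∀ {e f : Edge X}, e ≤ f → f.star ≤ e.star := fun {e f} h => by
    refine ⟨?_, fun h' => ?_⟩
    · rw [toSet_star, toSet_star]
      exact h.1.compl (hess e) (hess f)
    · rw [toSet_star, toSet_star, compl_inj_iff] at h'
      rw [key_star, key_star]
      exact neg_le_neg (h.2 h'.symm)
  have not_le_star : ∀ {e f : Edge X}, e ≤ f → ¬ e ≤ f.star := fun {e f} h h' =>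
    not_almostLE_compl (hess e) h.1.1 (by have := h'.1.1; rwa [toSet_star] at this)
  have comparable : ∀ {e f : Edge X}, AlmostLE e.toSet f.toSet → e ≤ f ∨ f ≤ e := fun {e f} h => by
    by_cases heq : e.toSet = f.toSet
    · rcases le_total e.key f.key with hk | hk
      · exact Or.inl ⟨.of_subset heq.subset, fun _ => hk⟩
      · exact Or.inr ⟨.of_subset heq.superset, fun _ => hk⟩
    · exact (h.cornerLE_or (subset_or_subset hX hpair h)).imp
        (fun h => ⟨h, fun h' => absurd h' heq⟩) fun h => ⟨h, fun h' => absurd h'.symm heq⟩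
  { star := star
    star_star := star_star
    star_le_star := star_le
    not_le_star := not_le_star
    nested := fun e f => by
      have star_le' : ∀ {x y : Edge X}, x ≤ y.star → y ≤ x.star := fun h => by
        simpa [star_star] using star_le h
      have star_le'' : ∀ {x y : Edge X}, x.star ≤ y → y.star ≤ x := fun h => by
        simpa [star_star] using star_le h
      have star_le''' : ∀ {x y : Edge X}, x.star ≤ y.star → y ≤ x := fun h => by
        simpa [star_star] using star_le h
      obtain ⟨e', f', rfl | rfl, rfl | rfl, h⟩ := exists_almostLE hX hnest e f
      · rcases comparable h with h | h
        exacts [Or.inl h, Or.inr (Or.inr (Or.inr h))]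
      · rcases comparable h with h | h
        exacts [Or.inr (Or.inl h), Or.inr (Or.inr (Or.inl (star_le'' h)))]
      · rcases comparable h with h | h
        exacts [Or.inr (Or.inr (Or.inl h)), Or.inr (Or.inl (star_le' h))]
      · rcases comparable h with h | h
        exacts [Or.inr (Or.inr (Or.inr (star_le''' h))), Or.inl (star_le''' h)]
    finite_Ioo := fun e f => by
      obtain ⟨u, -, hu⟩ := exists_mem_of_cornerLE hH hX e
      obtain ⟨v, -, hv⟩ := exists_mem_of_cornerLE hH hX f.star
      refine (finite_separating hX u v).subset fun x hx => ⟨hu x hx.1.le.1, ?_⟩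
      have := hv x.star (star_le hx.2.le).1
      rwa [toSet_star] at this
    smul_le_smul := fun g e f h => by
      refine ⟨?_, fun h' => ?_⟩
      · rw [toSet_smul, toSet_smul]
        exact h.1.smul g
      · rw [toSet_smul, toSet_smul, smul_left_cancel_iff] at h'
        exact h.2 h'
    smul_star := fun _ _ => rfl
    color := color
    positive := positive
    edge := ofIndex X
    color_star := fun _ => rfl
    color_smul := fun _ _ => rfl
    color_edge := fun _ => rfl
    positive_star := fun _ => rfl
    positive_smul := fun _ _ => rfl
    positive_edge := fun _ => rfl
    exists_smul_edge := fun e he => by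
      obtain ⟨g, hg⟩ := e.exists_smul
      exact ⟨g, Edge.ext rfl hg he⟩ }

theorem stabilizer_ofIndex (i : Fin k) :
    MulAction.stabilizer G (ofIndex X i) = MulAction.stabilizer G (X i) := by
  ext g
  exact ⟨fun h => congrArg carrier h, fun h => Edge.ext rfl h rfl⟩

theorem finiteOver_stabilizer_ofIndex (hX : ∀ i, IsNontrivialAlmostInvariant (H i) (X i))
    (i : Fin k) :
    FiniteOver (H i) (MulAction.stabilizer G (ofIndex X i) : Set G) := by
  rw [stabilizer_ofIndex]
  exact (hX i).finiteOver_stabilizer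

section

variable [Group.FG G] (hH : ∀ i, (H i).FG)
  (hX : ∀ i, IsNontrivialAlmostInvariant (H i) (X i)) (hnest : AlmostNested (translates H X))
  (hpair : ∀ p ∈ translates H X, ∀ q ∈ translates H X, SmallPairHasEmpty p.1 p.2 q.2) (i : Fin k)

/-- Up to an `H i`-finite set, the elements that carry the edge of `X i` beyond its tail are in
`X i`, and those that carry it beyond its head are not. -/
theorem finiteOver_beyond :
    letI := partialOrder fun i => (hX i).of_stabilizer
    FiniteOver (H i) ((treeOrder hH hX hnest hpair).beyond i (ofIndex X i).star \ X i) ∧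
      FiniteOver (H i) ((treeOrder hH hX hnest hpair).beyond i (ofIndex X i) ∩ X i) := by
  let := partialOrder fun i => (hX i).of_stabilizer
  let T := treeOrder hH hX hnest hpair
  obtain ⟨u, -, hu⟩ := exists_mem_of_cornerLE hH hX (ofIndex X i)
  obtain ⟨v, -, hv⟩ := exists_mem_of_cornerLE hH hX (ofIndex X i).star
  have hbu := (hX i).1.finiteOver_boundary u
  have hbv := (hX i).1.finiteOver_boundary v
  have mem : ∀ (g x : G), x ∈ (g⁻¹ • ofIndex X i).toSet ↔ g * x ∈ X i := fun g x => by
    rw [toSet_smul, Set.mem_smul_set_iff_inv_smul_mem, inv_inv]; rfl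
  have mem' : ∀ (g x : G), x ∈ (g⁻¹ • ofIndex X i).star.toSet ↔ g * x ∉ X i := fun g x => by
    rw [toSet_star, Set.mem_compl_iff, mem]
  have move : ∀ {g : G} {p q : Edge X}, p ≤ g • q → g⁻¹ • p ≤ q := fun {g p q} h => by
    simpa using T.smul_le_smul g⁻¹ h
  -- for `g` in the first set, the edge `e` of `X i` satisfies `star e < g⁻¹ • e` or `e < g⁻¹ • e`, so
  -- that `g * v` or `g * u` is in `X i`, and `g` is in the boundary of `X i`; similarly for the second
  constructor
  · refine (hbu.union hbv).mono ?_
    rintro g ⟨hg | hg, hgX⟩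
    · refine Or.inr fun h => hgX (h.1 ((mem g v).1 (hv _ ?_)))
      exact (T.star_le_comm.1 (move hg.le)).1
    · refine Or.inl fun h => hgX (h.1 ((mem g u).1 (hu _ ?_)))
      have := T.star_le_star (move hg.le)
      rw [T.star_star] at this
      exact this.1
  · refine (hbu.union hbv).mono ?_
    rintro g ⟨hg | hg, hgX⟩
    · refine Or.inr fun h => (mem' g v).1 (hv _ ?_) (h.2 hgX)
      exact (T.star_le_star (move hg.le)).1
    · refine Or.inl fun h => (mem' g u).1 (hu _ ?_) (h.2 hgX)
      exact (T.le_star_comm.1 (move hg.le)).1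

/-- If an end of the collapsed edge were fixed by `G`, then all elements would fix the edge or carry
it beyond this end, and `X i` or its complement would be `H i`-finite. -/
theorem stabilizer_collapsedEnd_ne_top (b : Bool) :
    letI := partialOrder fun i => (hX i).of_stabilizer
    MulAction.stabilizer G ((treeOrder hH hX hnest hpair).collapsedEnd i b) ≠ ⊤ := by
  let := partialOrder fun i => (hX i).of_stabilizer
  let T := treeOrder hH hX hnest hpair
  intro htop
  have h : ∀ g : G, g ∈ MulAction.stabilizer G (ofIndex X i) ∨ g ∈ T.beyond i (T.towards i b) := by
    intro g
    have hg : g ∈ MulAction.stabilizer G (T.collapsedEnd i b) := htop ▸ Subgroup.mem_top g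
    refine (T.towards_lt_of_smul_collapsedEnd hg).imp And.right fun h => ?_
    cases b
    · exact Or.inr h
    · exact Or.inl h
  obtain ⟨h₁, h₂⟩ := finiteOver_beyond hH hX hnest hpair i
  have hC := finiteOver_stabilizer_ofIndex hX i
  cases b
  · refine (hX i).2.1 ((hC.union h₂).mono fun g hg => ?_)
    exact (h g).imp id fun h => ⟨h, hg⟩
  · refine (hX i).2.2 ((hC.union h₁).mono fun g hg => ?_)
    exact (h g).imp id fun h => ⟨h, hg⟩

end

/-- The decomposition of `G` given by a finite family of almost nested sets. -/
theorem exists_graphOfGroups [Group.FG G] (hH : ∀ i, (H i).FG)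
    (hX : ∀ i, IsNontrivialAlmostInvariant (H i) (X i)) (hnest : AlmostNested (translates H X))
    (hpair : ∀ p ∈ translates H X, ∀ q ∈ translates H X, SmallPairHasEmpty p.1 p.2 q.2) :
    ∃ (V : Type u) (𝒢 : GraphOfGroups.{u, 0, u, u} V (Fin k)) (v₀ : V)
      (θ : 𝒢.FundamentalGroup v₀ ≃* G) (s : Fin k → Splitting G),
      ∀ i, 𝒢.CollapsesTo θ i (s i) ∧ (s i).edge = MulAction.stabilizer G (X i) ∧
        ∃ Y : Set G, (s i).IsStandardSet Y ∧ AlmostEqual (H i) Y (X i) := by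
  let := partialOrder fun i => (hX i).of_stabilizer
  let T := treeOrder hH hX hnest hpair
  -- without any sets `X i` the tree is a single point
  have hv : Nonempty T.Vertex := by
    by_cases hP : IsEmpty (Edge X)
    · exact ⟨⟨∅, Or.inr hP⟩⟩
    · obtain ⟨e⟩ := not_isEmpty_iff.1 hP
      exact ⟨T.headVertex e⟩
  obtain ⟨x⟩ := hv
  choose s hs hedge Y hY h₁ h₂ using fun i => T.exists_splitting i (T.orbit x)
    (stabilizer_collapsedEnd_ne_top hH hX hnest hpair i)
  refine ⟨_, T.graph, T.orbit x, T.fundamentalGroupEquiv _, s, fun i => ⟨hs i,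
    (hedge i).trans (stabilizer_ofIndex i), Y i, hY i, ?_⟩⟩
  obtain ⟨hb₁, hb₂⟩ := finiteOver_beyond hH hX hnest hpair i
  refine (((finiteOver_stabilizer_ofIndex hX i).union hb₁).union hb₂).mono fun g hg => ?_
  rcases T.mem_beyond_or i g with hC | hZ | hZ
  · exact Or.inl (Or.inl hC)
  · rcases hg with hg | hg
    · exact absurd hZ (h₂ i hg.1)
    · exact Or.inr ⟨hZ, hg.1⟩
  · rcases hg with hg | hg
    · exact Or.inl (Or.inr ⟨hZ, hg.2⟩)
    · exact absurd (h₁ i hZ) hg.2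

end Edge

/-- For a single set the condition on pairs of small corners need only be checked for the set and its
translates. -/
theorem smallPairHasEmpty_translates {G ι : Type*} [Group G] {H : Subgroup G} {X : Set G}
    (h : ∀ g : G, SmallPairHasEmpty H X (g • X)) :
    ∀ p ∈ translates (fun _ : ι => H) (fun _ => X),
      ∀ q ∈ translates (fun _ : ι => H) (fun _ => X), SmallPairHasEmpty p.1 p.2 q.2 := by
  rintro _ ⟨_, g, a, rfl⟩ _ ⟨_, g', a', rfl⟩
  intro c d c' d' hne hcd hcd'
  have key : ∀ x y, corner (side (g • X) a) (side (g' • X) a') x y =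
      g • corner X ((g⁻¹ * g') • X) (a == x) (a' == y) := fun x y => by
    rw [corner, corner, side_side, side_side, Set.smul_set_inter, ← side_smul, ← side_smul,
      smul_smul, mul_inv_cancel_left]
  dsimp only at hcd hcd' ⊢
  rw [key, finiteOver_conj, inv_smul_smul] at hcd hcd'
  rw [key, key, Set.smul_set_eq_empty, Set.smul_set_eq_empty]
  refine h _ _ _ _ _ (fun heq => hne ?_) hcd hcd'
  revert heq
  cases a <;> cases a' <;> cases c <;> cases c' <;> cases d <;> cases d' <;> simp

end AlmostInvariant

theorem mainTheorem3 {G : Type u} [Group G] [Group.FG G] :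
    (∀ (H : Subgroup G) (X : Set G), H.FG → IsNontrivialAlmostInvariant H X →
      AlmostNested (translates (fun _ : Unit => H) (fun _ : Unit => X)) →
      (∀ g : G, SmallPairHasEmpty H X (g • X)) →
      H ≤ MulAction.stabilizer G X ∧ H.relIndex (MulAction.stabilizer G X) ≠ 0 ∧
      ∃ s : Splitting G, s.edge = MulAction.stabilizer G X ∧
        ∃ Y : Set G, s.IsStandardSet Y ∧ AlmostEqual H Y X) ∧
    (∀ (k : ℕ) (H : Fin k → Subgroup G) (X : Fin k → Set G), (∀ i, (H i).FG) →
      (∀ i, IsNontrivialAlmostInvariant (H i) (X i)) →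
      AlmostNested (translates H X) →
      (∀ p ∈ translates H X, ∀ q ∈ translates H X, SmallPairHasEmpty p.1 p.2 q.2) →
      (∀ i, H i ≤ MulAction.stabilizer G (X i) ∧
        (H i).relIndex (MulAction.stabilizer G (X i)) ≠ 0) ∧
      ∃ (V : Type u) (𝒢 : GraphOfGroups.{u, 0, u, u} V (Fin k)) (v₀ : V)
        (θ : 𝒢.FundamentalGroup v₀ ≃* G) (s : Fin k → Splitting G),
        ∀ i, 𝒢.CollapsesTo θ i (s i) ∧ (s i).edge = MulAction.stabilizer G (X i) ∧
          ∃ Y : Set G, (s i).IsStandardSet Y ∧ AlmostEqual (H i) Y (X i)) := by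
  refine ⟨fun H X hH hX hnest hpair => ⟨hX.1.le_stabilizer,
    relIndex_ne_zero_of_finiteOver hX.finiteOver_stabilizer, ?_⟩,
    fun k H X hH hX hnest hpair => ⟨fun i => ⟨(hX i).1.le_stabilizer,
      relIndex_ne_zero_of_finiteOver (hX i).finiteOver_stabilizer⟩,
      Edge.exists_graphOfGroups hH hX hnest hpair⟩⟩
  have htr : translates (fun _ : Fin 1 => H) (fun _ => X) =
      translates (fun _ : Unit => H) (fun _ => X) := by
    ext p
    exact ⟨fun ⟨_, h⟩ => ⟨(), h⟩, fun ⟨_, h⟩ => ⟨0, h⟩⟩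
  obtain ⟨_, _, _, _, s, hs⟩ := Edge.exists_graphOfGroups (H := fun _ : Fin 1 => H)
    (X := fun _ => X) (fun _ => hH) (fun _ => hX) (htr ▸ hnest) (smallPairHasEmpty_translates hpair)
  exact ⟨s 0, (hs 0).2⟩
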